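/- A map $f\colon U\to F$ from an open subset $U$ of a Hausdorff real locally convex space $E$ to a Hausdorff real locally convex space $F$ is of class $C^0$ if it is continuous, and of class $C^{k+1}$ if it is continuous, the directional derivatives $df(p,v)=\lim_{t\to 0}t^{-1}(f(p+tv)-f(p))$ exist for all $p\in U$, $v\in E$, and $df\colon U\times E\to F$ is of class $C^k$; it is smooth if it is of class $C^k$ for all $k\in\mathbb N$. Manifolds (always Hausdorff), smooth maps between them and Lie groups (manifolds with a group structure whose multiplication and inversion are smooth) modelled on $E$ are understood with respect to this notion of smoothness. For a Lie group $G$ let $L(G)=T_1G$ be its Lie algebra, with the bracket given by left invariant vector fields. An exponential map of $G$ is a smooth map $\exp_G\colon L(G)\to G$ such that for every $v\in L(G)$ the curve $t\mapsto\exp_G(tv)$ is a one-parameter group with derivative $v$ at $t=0$. A subset $N$ of a manifold $M$ modelled on $E$ is an immersed submanifold if $N$ carries the structure of a smooth manifold modelled on a closed vector subspace $S$ of $E$ such that the inclusion $\iota\colon N\to M$ is continuous and for every $p\in N$ there are charts $\varphi\colon U_\varphi\to V_\varphi$ of $N$ and $\psi\colon U_\psi\to V_\psi$ of $M$ around $p$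 with $U_\varphi\subseteq U_\psi$ and $\psi\circ\iota\circ\varphi^{-1}(x)=x$ for all $x\in V_\varphi\subseteq S\subseteq E$. **Theorem.** Let $G$ be a Lie group modelled on a Hausdorff real locally convex space $E$ that has an exponential map. Let $\mathfrak h\subseteq L(G)$ be a Lie subalgebra that is complemented as a topological vector subspace and is a Banach space (i.e. its topology is given by a complete norm) in the induced topology. Then there is a subgroup $H$ of $G$ and a manifold structure on $H$ (whose topology may be finer than the induced one) that makes $H$ both a Lie group and an immersed submanifold of $G$, such that $L(H)=\mathfrak h$, that is, $T_1\iota(T_1H)=\mathfrak h$ for the inclusion $\iota\colon H\to G$. -/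

import Mathlib

open Set Filter Topology

noncomputable section

namespace LCLie

/-! ### Keller's `C^r_c` differential calculus on real topological vector spaces -/

section Calculus

variable {E : Type*} [AddCommGroup E] [Module ℝ E] [TopologicalSpace E]
  {F : Type*} [AddCommGroup F] [Module ℝ F] [TopologicalSpace F]

/-- `d` is the directional derivative of `f` at `p` in direction `v`. -/
def HasDirDeriv (f : E → F) (p v : E) (d : F) : Prop :=
  Tendsto (fun t : ℝ => t⁻¹ • (f (p + t • v) - f p)) (𝓝[≠] 0) (𝓝 d)

/-- The directional derivative `df(p, v)` (meaningful when the limit exists). -/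
def dirDeriv (f : E → F) (p v : E) : F :=
  limUnder (𝓝[≠] (0 : ℝ)) (fun t : ℝ => t⁻¹ • (f (p + t • v) - f p))

end Calculus

universe u

/-- `f` is of class `C^n` on the (open) set `U`: it is continuous and, for `n = k + 1`, all its
directional derivatives exist on `U` and `df : U × E → F` is of class `C^k`. -/
def IsCr {F : Type*} [AddCommGroup F] [Module ℝ F] [TopologicalSpace F] :
    ℕ → ∀ {E : Type u} [AddCommGroup E] [Module ℝ E] [TopologicalSpace E],
      (E → F) → Set E → Prop
  | 0, _, _, _, _, f, U => ContinuousOn f U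
  | n + 1, E, _, _, _, f, U => ContinuousOn f U ∧
      ∃ df : E × E → F, (∀ p ∈ U, ∀ v, HasDirDeriv f p v (df (p, v))) ∧ IsCr n df (U ×ˢ univ)

/-- `f` is smooth (of class `C^∞`) on the (open) set `U`. -/
def SmoothOn {E : Type*} [AddCommGroup E] [Module ℝ E] [TopologicalSpace E]
    {F : Type*} [AddCommGroup F] [Module ℝ F] [TopologicalSpace F]
    (f : E → F) (U : Set E) : Prop :=
  ∀ n : ℕ, IsCr n f U

/-! ### Manifolds modelled on a locally convex space -/

section Manifold

variable (E : Type*) [AddCommGroup E] [Module ℝ E] [TopologicalSpace E]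
  (F : Type*) [AddCommGroup F] [Module ℝ F] [TopologicalSpace F]
  {M : Type*} [TopologicalSpace M] [ChartedSpace E M]
  {N : Type*} [TopologicalSpace N] [ChartedSpace F N]

/-- The change of charts from `e` to `e'` is smooth. -/
def SmoothChange {E : Type*} [AddCommGroup E] [Module ℝ E] [TopologicalSpace E]
    {M : Type*} [TopologicalSpace M] (e e' : OpenPartialHomeomorph M E) : Prop :=
  SmoothOn (fun z => e' (e.symm z)) (e.symm.trans e').source

/-- `M`, with its given atlas, is a (Hausdorff) smooth manifold modelled on `E`. -/
structure IsManifold (M : Type*) [TopologicalSpace M] [ChartedSpace E M] : Prop where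
  t2 : T2Space M
  smooth_change : ∀ e ∈ atlas E M, ∀ e' ∈ atlas E M, SmoothChange e e'

/-- The maximal atlas: all charts smoothly compatible with the given atlas. -/
def maxAtlas (M : Type*) [TopologicalSpace M] [ChartedSpace E M] :
    Set (OpenPartialHomeomorph M E) :=
  {e | ∀ e' ∈ atlas E M, SmoothChange e e' ∧ SmoothChange e' e}

/-- The product of two manifolds, with products of charts as charts. -/
instance prodCharts {E : Type*} [TopologicalSpace E] {F : Type*} [TopologicalSpace F]
    {M : Type*} [TopologicalSpace M] [ChartedSpace E M]
    {N : Type*} [TopologicalSpace N] [ChartedSpace F N] : ChartedSpace (E × F) (M × N) :=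
  prodChartedSpace E M F N

/-- `f : M → N` is smooth: it is continuous and smooth in local charts. -/
def SmoothMap (f : M → N) : Prop :=
  Continuous f ∧ ∀ e ∈ atlas E M, ∀ e' ∈ atlas F N,
    SmoothOn (fun z => e' (f (e.symm z))) (e.target ∩ {z | f (e.symm z) ∈ e'.source})

/-- The tangent space `T_x M`, identified with the modelling space `E` through the differential
of the preferred chart `chartAt E x` around `x`. -/
abbrev TangentAt {M : Type*} (_ : M) : Type _ := E

/-- The tangent map `T_x f : T_x M → T_{f x} N`. -/
def tangentMap (f : M → N) (x : M) (v : TangentAt E x) : TangentAt F (f x) :=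
  dirDeriv (fun z : E => chartAt F (f x) (f ((chartAt E x).symm z))) (chartAt E x x) v

/-- The local representative `y ↦ dφ (X (φ⁻¹ y))` of a vector field `X` in the chart `φ`. -/
def localRep (X : ∀ x : M, TangentAt E x) (φ : OpenPartialHomeomorph M E) (y : E) : E :=
  tangentMap E E φ (φ.symm y) (X (φ.symm y))

/-- The Lie bracket of vector fields, `[X, Y] = dY(X) - dX(Y)` in the preferred chart at `p`. -/
def vfBracket (X Y : ∀ x : M, TangentAt E x) (p : M) : TangentAt E p :=
  dirDeriv (localRep E Y (chartAt E p)) (chartAt E p p) (localRep E X (chartAt E p) (chartAt E p p))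
    - dirDeriv (localRep E X (chartAt E p)) (chartAt E p p)
        (localRep E Y (chartAt E p) (chartAt E p p))

/-- The injective map `j : N → M` makes the smooth manifold `N`, modelled on the closed vector
subspace `S` of `E`, an immersed submanifold of `M`: `j` is continuous, and around each point there
are charts in which `j` is the inclusion of `S` in `E`. -/
structure IsImmersedSubmanifold (S : Submodule ℝ E) {N : Type*} [TopologicalSpace N]
    [ChartedSpace S N] (j : N → M) : Prop where
  isClosed : IsClosed (S : Set E)
  isManifold : IsManifold S N
  injective : Function.Injective j
  continuous : Continuous j
  charts : ∀ p : N, ∃ φ ∈ maxAtlas S N, ∃ ψ ∈ maxAtlas E M,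
    p ∈ φ.source ∧ (∀ q ∈ φ.source, j q ∈ ψ.source) ∧ ∀ x ∈ φ.target, ψ (j (φ.symm x)) = (x : E)

end Manifold

/-! ### Lie groups modelled on a locally convex space -/

section LieGroup

variable (E : Type*) [AddCommGroup E] [Module ℝ E] [TopologicalSpace E]
  (G : Type*) [Group G] [TopologicalSpace G] [ChartedSpace E G]

/-- `G` is a Lie group modelled on `E`: a smooth manifold with smooth group operations. -/
structure IsLieGroup : Prop extends IsManifold E G where
  smooth_mul : SmoothMap (E × E) E (fun z : G × G => z.1 * z.2)
  smooth_inv : SmoothMap E E (fun g : G => g⁻¹)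

/-- The Lie algebra `L(G) = T_1 G`. -/
abbrev LieAlg : Type _ := TangentAt E (1 : G)

variable {G}

/-- The left invariant vector field `g ↦ T_1 λ_g (v)` given by `v ∈ L(G)`. Its value lies
in `T_{g * 1} G`, and `g * 1 = g`. -/
def leftInv (v : LieAlg E G) (g : G) : TangentAt E g :=
  tangentMap E E (fun x : G => g * x) 1 v

/-- The Lie bracket of `L(G)`: `[v, w]` is the value at `1` of the bracket of the left invariant
vector fields given by `v` and `w`. -/
def lieBracket (v w : LieAlg E G) : LieAlg E G :=
  vfBracket E (leftInv E v) (leftInv E w) (1 : G)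

variable (G) in
/-- The vector subspace `h` of `L(G)` is a Lie subalgebra. -/
def IsLieSubalgebra (h : Submodule ℝ (LieAlg E G)) : Prop :=
  ∀ v ∈ h, ∀ w ∈ h, lieBracket E (G := G) v w ∈ h

/-- `ex : L(G) → G` is an exponential map: it is smooth and, for each `v ∈ L(G)`, the curve
`t ↦ ex (t v)` is a one-parameter group with derivative `v` at `0`. -/
structure IsExponentialMap (ex : LieAlg E G → G) : Prop where
  smooth : SmoothMap E E ex
  add_smul : ∀ (v : LieAlg E G) (s t : ℝ), ex ((s + t) • v) = ex (s • v) * ex (t • v)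
  hasDeriv : ∀ v : LieAlg E G, HasDirDeriv (fun t : ℝ => chartAt E (1 : G) (ex (t • v))) 0 1 v

end LieGroup

/-- The topological vector space `V` is a Banach space: its topology is given by a complete
norm. -/
def IsBanach (V : Type u) [AddCommGroup V] [Module ℝ V] [TopologicalSpace V] : Prop :=
  ∃ (B : Type u) (_ : NormedAddCommGroup B) (_ : NormedSpace ℝ B) (_ : CompleteSpace B),
    Nonempty (B ≃L[ℝ] V)

end LCLie

end

/-!
The subgroup is generated by the exponentials of `𝔥`, and no differential equation has to be solved to
find its leaves: the exponential map provides them.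

Write `𝔥` as the image of a Banach space `B` under `ι`, with `pr` a continuous left inverse of `ι`.

* For `v ∈ 𝔥` the curve `s ↦ Ad (exp (-s v)) (e^{s ad v} w)` has derivative zero, where
  `e^{s ad v}` is computed in the Banach space `B`. Hence `Ad (exp v)` maps `𝔥` to `𝔥`
  (`IsExponentialMap.Ad_mem`). This rests on `[v, w]` being the derivative of `Ad` at `1`
  (`lieBracket_eq_dirDeriv_Ad`).
* The left logarithmic derivative of `exp` satisfies `N (s + t) = Ad (exp (-s v)) (N t) + N s` along
  `s ↦ s v`, so its derivative in `s` is `Ad (exp (-s v)) w ∈ 𝔥`. Hence it maps `𝔥` to `𝔥` at each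
  point of `𝔥`, and it is onto `𝔥` near `0` since it is close to the identity in operator norm
  (`IsExponentialMap.eventually_expLogDeriv_surjective`).
* With an implicit function theorem for Banach-valued maps with parameters in a locally convex space
  (`exists_implicit`), the map `c + b ↦ φ⁻¹(φ 1 + c) exp b`, with `b ∈ 𝔥` and `c` in the complement, is
  seen to be the inverse of a chart `ψ` of `G` (`exists_sliceChart`). By the previous point, its slices
  `c = const` are tangent to the left invariant vector fields given by `𝔥`. So the `c`-coordinate is
  constant along `t ↦ g exp (t w)` for `w ∈ 𝔥` (`sliceChart_const`), and `exp b exp b'` is again an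
  exponential of an element of `𝔥` for small `b`, `b'` (`exists_isLocalExpChart`).
* The exponentials of small balls of `B` are thus a basis of neighbourhoods of `1` for a group topology
  on the generated subgroup (`expGroupFilterBasis`), and translates of the exponential coordinates are
  charts. A map into the subgroup is smooth once it is continuous and smooth as a map to `G`, because
  these charts are restrictions of translates of `ψ` (`smoothAt_expChart`), so the group operations are
  smooth.

The calculus needed for this in locally convex spaces comes from the mean value theorem
`sub_mem_of_hasDirDeriv_mem`, a consequence of the Hahn-Banach theorem. It shows that difference
quotients of `C^1` maps converge locally uniformly (`IsCr.tendsto_quotient`), which yields linearity of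
the differential, the chain rule and Schwarz's theorem.
-/

set_option linter.unusedSectionVars false

namespace LCLie

/-! ### Directional derivatives and the mean value theorem -/

section DirDeriv

variable {E : Type*} [AddCommGroup E] [Module ℝ E] [TopologicalSpace E]
  [IsTopologicalAddGroup E] [ContinuousSMul ℝ E]
  {F : Type*} [AddCommGroup F] [Module ℝ F] [TopologicalSpace F]
  [IsTopologicalAddGroup F] [ContinuousSMul ℝ F]
  {K : Type*} [AddCommGroup K] [Module ℝ K] [TopologicalSpace K]

theorem tendsto_line (p v : E) : Tendsto (fun t : ℝ => p + t • v) (𝓝 0) (𝓝 p) := by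
  have : Continuous (fun t : ℝ => p + t • v) := by fun_prop
  simpa using this.tendsto 0

theorem HasDirDeriv.dirDeriv_eq [T2Space K] {f : E → K} {p v : E} {d : K}
    (h : HasDirDeriv f p v d) : dirDeriv f p v = d :=
  Tendsto.limUnder_eq h

theorem HasDirDeriv.unique [T2Space K] {f : E → K} {p v : E} {d d' : K}
    (h : HasDirDeriv f p v d) (h' : HasDirDeriv f p v d') : d = d' :=
  tendsto_nhds_unique h h'

theorem HasDirDeriv.congr {f g : E → K} {p v : E} {d : K}
    (h : HasDirDeriv f p v d) (hfg : f =ᶠ[𝓝 p] g) : HasDirDeriv g p v d := by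
  refine Tendsto.congr' ?_ h
  have h1 := (tendsto_line p v).eventually hfg
  filter_upwards [nhdsWithin_le_nhds h1] with t ht
  rw [ht, hfg.self_of_nhds]

theorem dirDeriv_congr {f g : E → K} {p : E} (hfg : f =ᶠ[𝓝 p] g) (v : E) :
    dirDeriv f p v = dirDeriv g p v := by
  unfold dirDeriv limUnder
  congr 1
  refine Filter.map_congr ?_
  have h1 := (tendsto_line p v).eventually hfg
  filter_upwards [nhdsWithin_le_nhds h1] with t ht
  rw [ht, hfg.self_of_nhds]

theorem hasDirDeriv_const (c : F) (p v : E) : HasDirDeriv (fun _ : E => c) p v 0 := by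
  simp only [HasDirDeriv, sub_self, smul_zero]
  exact tendsto_const_nhds

theorem hasDirDeriv_clm (A : E →L[ℝ] F) (p v : E) : HasDirDeriv A p v (A v) := by
  refine Tendsto.congr' ?_ tendsto_const_nhds
  filter_upwards [self_mem_nhdsWithin] with t ht
  have ht : t ≠ 0 := ht
  simp [smul_smul, ht]

theorem HasDirDeriv.prodMk {f : E → F} {g : E → K} {p v : E} {d : F} {d' : K}
    (hf : HasDirDeriv f p v d) (hg : HasDirDeriv g p v d') :
    HasDirDeriv (fun x => (f x, g x)) p v (d, d') :=
  Filter.Tendsto.prodMk_nhds hf hg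

theorem HasDirDeriv.clm_comp [IsTopologicalAddGroup K] [ContinuousSMul ℝ K] {f : E → F} {p v : E}
    {d : F} (hf : HasDirDeriv f p v d) (A : F →L[ℝ] K) :
    HasDirDeriv (fun x => A (f x)) p v (A d) := by
  have := (A.continuous.tendsto d).comp hf
  refine this.congr fun t => ?_
  simp

theorem HasDirDeriv.const_smul {f : E → F} {p v : E} {d : F} (hf : HasDirDeriv f p v d) (c : ℝ) :
    HasDirDeriv (fun x => c • f x) p v (c • d) := by
  refine (Tendsto.const_smul hf c).congr fun t => ?_
  rw [smul_comm, smul_sub]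

theorem HasDirDeriv.comp_clm {f : F → K} (A : E →L[ℝ] F) {p v : E} {d : K}
    (hf : HasDirDeriv f (A p) (A v) d) : HasDirDeriv (fun x => f (A x)) p v d := by
  refine Tendsto.congr (fun t => ?_) hf
  simp

theorem HasDirDeriv.add {f g : E → F} {p v : E} {d d' : F}
    (hf : HasDirDeriv f p v d) (hg : HasDirDeriv g p v d') :
    HasDirDeriv (fun x => f x + g x) p v (d + d') := by
  refine (Tendsto.add hf hg).congr fun t => ?_
  rw [← smul_add, add_sub_add_comm]

theorem HasDirDeriv.neg {f : E → F} {p v : E} {d : F}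
    (hf : HasDirDeriv f p v d) : HasDirDeriv (fun x => - f x) p v (-d) := by
  refine (Tendsto.neg hf).congr fun t => ?_
  rw [← smul_neg, neg_sub_neg, neg_sub]

theorem HasDirDeriv.sub {f g : E → F} {p v : E} {d d' : F}
    (hf : HasDirDeriv f p v d) (hg : HasDirDeriv g p v d') :
    HasDirDeriv (fun x => f x - g x) p v (d - d') := by
  simpa [sub_eq_add_neg] using hf.add hg.neg

/-- Reduction of a directional derivative to the derivative of a curve. -/
theorem hasDirDeriv_curve_iff {f : E → K} {p v : E} {d : K} :
    HasDirDeriv (fun t : ℝ => f (p + t • v)) 0 1 d ↔ HasDirDeriv f p v d := by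
  simp [HasDirDeriv]

/-- The derivative of `f` along the line through `p` with direction `v` at time `s`. -/
theorem HasDirDeriv.line {f : E → K} {p v : E} {s : ℝ} {d : K}
    (h : HasDirDeriv f (p + s • v) v d) : HasDirDeriv (fun t : ℝ => f (p + t • v)) s 1 d := by
  refine Tendsto.congr (fun t => ?_) h
  simp [add_smul, add_assoc]

theorem HasDirDeriv.smul_dir {f : E → F} {p v : E} {d : F} (h : HasDirDeriv f p v d) (c : ℝ) :
    HasDirDeriv f p (c • v) (c • d) := by
  rcases eq_or_ne c 0 with rfl | hc
  · simp only [HasDirDeriv, smul_zero, add_zero, sub_self, zero_smul]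
    exact tendsto_const_nhds
  · have h1 : Tendsto (fun t : ℝ => t * c) (𝓝[≠] 0) (𝓝[≠] 0) := by
      refine tendsto_nhdsWithin_iff.2 ⟨?_, ?_⟩
      · have : Continuous fun t : ℝ => t * c := by fun_prop
        have h0 := this.tendsto 0
        rw [zero_mul] at h0
        exact h0.mono_left nhdsWithin_le_nhds
      · filter_upwards [self_mem_nhdsWithin] with t ht
        exact mul_ne_zero ht hc
    refine ((Tendsto.comp h h1).const_smul c).congr fun t => ?_
    simp only [Function.comp, smul_smul, mul_inv]
    congr 1
    field_simp

theorem hasDirDeriv_iff_hasDerivAt {B : Type*} [NormedAddCommGroup B] [NormedSpace ℝ B]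
    {c : ℝ → B} {s : ℝ} {d : B} : HasDirDeriv c s 1 d ↔ HasDerivAt c d s := by
  rw [hasDerivAt_iff_tendsto_slope_zero]
  simp [HasDirDeriv]

/-- **Mean value theorem**: if the derivative of a curve takes its values in a closed convex set on
`[0, 1]`, then so does its increment. -/
theorem sub_mem_of_hasDirDeriv_mem [LocallyConvexSpace ℝ F] {c d : ℝ → F} {W : Set F}
    (hW : Convex ℝ W) (hWc : IsClosed W)
    (hc : ∀ s ∈ Icc (0 : ℝ) 1, HasDirDeriv c s 1 (d s))
    (hd : ∀ s ∈ Icc (0 : ℝ) 1, d s ∈ W) : c 1 - c 0 ∈ W := by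
  by_contra hn
  obtain ⟨l, u, h1, h2⟩ := geometric_hahn_banach_closed_point hW hWc hn
  have hder : ∀ s ∈ Icc (0 : ℝ) 1, HasDerivAt (fun t => l (c t)) (l (d s)) s := fun s hs =>
    hasDirDeriv_iff_hasDerivAt.1 ((hc s hs).clm_comp l)
  obtain ⟨s, hs, hs'⟩ := exists_hasDerivAt_eq_slope (fun t => l (c t)) (fun s => l (d s))
    zero_lt_one (fun s hs => (hder s hs).continuousAt.continuousWithinAt)
    (fun s hs => hder s (Ioo_subset_Icc_self hs))
  have h3 := h1 _ (hd s (Ioo_subset_Icc_self hs))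
  simp only [map_sub, sub_zero, div_one] at h2 hs'
  linarith

theorem eq_of_hasDirDeriv_zero [LocallyConvexSpace ℝ F] [T2Space F] {c : ℝ → F}
    (hc : ∀ s ∈ Icc (0 : ℝ) 1, HasDirDeriv c s 1 0) : c 1 = c 0 := by
  have := sub_mem_of_hasDirDeriv_mem (W := {(0 : F)}) (convex_singleton 0) isClosed_singleton hc
    (fun _ _ => rfl)
  exact sub_eq_zero.1 this

/-- In a locally convex space every neighbourhood contains a closed convex one. -/
theorem exists_closed_convex_nhds [LocallyConvexSpace ℝ F] {x : F} {U : Set F} (hU : U ∈ 𝓝 x) :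
    ∃ W ∈ 𝓝 x, Convex ℝ W ∧ IsClosed W ∧ W ⊆ U := by
  obtain ⟨V, hV, hVc, hVU⟩ := exists_mem_nhds_isClosed_subset hU
  obtain ⟨W, ⟨hW, hWc⟩, hWV⟩ := (LocallyConvexSpace.convex_basis (𝕜 := ℝ) x).mem_iff.1 hV
  exact ⟨closure W, mem_of_superset hW subset_closure, Convex.closure hWc, isClosed_closure,
    (closure_minimal hWV hVc).trans hVU⟩

end DirDeriv

/-! ### Maps of class `C^n` -/

section Cr

universe u v w

variable {E : Type u} [AddCommGroup E] [Module ℝ E] [TopologicalSpace E]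
  [IsTopologicalAddGroup E] [ContinuousSMul ℝ E]
  {F : Type v} [AddCommGroup F] [Module ℝ F] [TopologicalSpace F]
  [IsTopologicalAddGroup F] [ContinuousSMul ℝ F]
  {K : Type w} [AddCommGroup K] [Module ℝ K] [TopologicalSpace K]
  [IsTopologicalAddGroup K] [ContinuousSMul ℝ K]

theorem IsCr.continuousOn {n : ℕ} {f : E → F} {U : Set E} (h : IsCr n f U) :
    ContinuousOn f U := by
  cases n with
  | zero => exact h
  | succ n => exact h.1

theorem IsCr.mono {n : ℕ} {f : E → F} {U V : Set E} (h : IsCr n f U) (hVU : V ⊆ U) :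
    IsCr n f V := by
  induction n generalizing E with
  | zero => exact ContinuousOn.mono h hVU
  | succ n ih =>
    obtain ⟨h0, df, h1, h2⟩ := h
    exact ⟨h0.mono hVU, df, fun p hp v => h1 p (hVU hp) v, ih h2 (prod_mono hVU subset_rfl)⟩

theorem IsCr.of_succ {n : ℕ} {f : E → F} {U : Set E} (h : IsCr (n + 1) f U) : IsCr n f U := by
  induction n generalizing E with
  | zero => exact h.1
  | succ n ih =>
    obtain ⟨h0, df, h1, h2⟩ := h
    exact ⟨h0, df, h1, ih h2⟩

theorem IsCr.congr {n : ℕ} {f g : E → F} {U : Set E} (h : IsCr n f U) (hU : IsOpen U)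
    (hfg : EqOn f g U) : IsCr n g U := by
  cases n with
  | zero => exact ContinuousOn.congr h hfg.symm
  | succ n =>
    obtain ⟨h0, df, h1, h2⟩ := h
    exact ⟨h0.congr hfg.symm, df, fun p hp v => (h1 p hp v).congr
      (hfg.eventuallyEq_of_mem (hU.mem_nhds hp)), h2⟩

theorem isCr_succ_iff [T2Space F] {n : ℕ} {f : E → F} {U : Set E} (hU : IsOpen U) :
    IsCr (n + 1) f U ↔ ContinuousOn f U ∧ (∀ p ∈ U, ∀ v, HasDirDeriv f p v (dirDeriv f p v)) ∧
      IsCr n (fun z : E × E => dirDeriv f z.1 z.2) (U ×ˢ univ) := by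
  constructor
  · rintro ⟨h0, df, h1, h2⟩
    have h3 : ∀ p ∈ U, ∀ v, dirDeriv f p v = df (p, v) := fun p hp v => (h1 p hp v).dirDeriv_eq
    refine ⟨h0, fun p hp v => by rw [h3 p hp v]; exact h1 p hp v,
      h2.congr (hU.prod isOpen_univ) fun z hz => (h3 z.1 hz.1 z.2).symm⟩
  · rintro ⟨h0, h1, h2⟩
    exact ⟨h0, _, h1, h2⟩

theorem isCr_of_local [T2Space F] {n : ℕ} {f : E → F} {U : Set E}
    (h : ∀ p ∈ U, ∃ V, IsOpen V ∧ p ∈ V ∧ IsCr n f V) : IsCr n f U := by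
  have hc : ContinuousOn f U := fun p hp => by
    obtain ⟨V, hV, hpV, h⟩ := h p hp
    exact (h.continuousOn.continuousAt (hV.mem_nhds hpV)).continuousWithinAt
  induction n generalizing E with
  | zero => exact hc
  | succ n ih =>
    refine ⟨hc, fun z => dirDeriv f z.1 z.2, fun p hp v => ?_, ?_⟩
    · obtain ⟨V, hV, hpV, h⟩ := h p hp
      exact ((isCr_succ_iff hV).1 h).2.1 p hpV v
    · have key : ∀ z ∈ U ×ˢ (univ : Set E), ∃ V, IsOpen V ∧ z ∈ V ∧
          IsCr n (fun z : E × E => dirDeriv f z.1 z.2) V := by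
        rintro ⟨p, v⟩ ⟨hp, -⟩
        obtain ⟨V, hV, hpV, h⟩ := h p hp
        exact ⟨V ×ˢ univ, hV.prod isOpen_univ, ⟨hpV, mem_univ _⟩, ((isCr_succ_iff hV).1 h).2.2⟩
      refine ih key fun z hz => ?_
      obtain ⟨V, hV, hpV, h⟩ := key z hz
      exact (h.continuousOn.continuousAt (hV.mem_nhds hpV)).continuousWithinAt

theorem isCr_const (n : ℕ) (c : F) (U : Set E) : IsCr n (fun _ : E => c) U := by
  induction n generalizing E c with
  | zero => exact continuousOn_const
  | succ n ih => exact ⟨continuousOn_const, fun _ => 0, fun p _ v => hasDirDeriv_const c p v, ih _ _⟩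

theorem isCr_clm (n : ℕ) (A : E →L[ℝ] F) (U : Set E) : IsCr n A U := by
  induction n generalizing E with
  | zero => exact A.continuous.continuousOn
  | succ n ih =>
    exact ⟨A.continuous.continuousOn, A.comp (ContinuousLinearMap.snd ℝ E E),
      fun p _ v => hasDirDeriv_clm A p v, ih _ _⟩

theorem IsCr.prodMk {n : ℕ} {f : E → F} {g : E → K} {U : Set E} (hf : IsCr n f U)
    (hg : IsCr n g U) : IsCr n (fun x => (f x, g x)) U := by
  induction n generalizing E with
  | zero => exact ContinuousOn.prodMk hf hg
  | succ n ih =>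
    obtain ⟨f0, df, f1, f2⟩ := hf
    obtain ⟨g0, dg, g1, g2⟩ := hg
    exact ⟨f0.prodMk g0, fun z => (df z, dg z), fun p hp v => (f1 p hp v).prodMk (g1 p hp v),
      ih f2 g2⟩

theorem IsCr.comp_clm {n : ℕ} {f : F → K} {U : Set F} (hf : IsCr n f U) (A : E →L[ℝ] F) :
    IsCr n (fun x => f (A x)) (A ⁻¹' U) := by
  induction n generalizing E F with
  | zero => exact ContinuousOn.comp hf A.continuous.continuousOn fun x hx => hx
  | succ n ih =>
    obtain ⟨f0, df, f1, f2⟩ := hf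
    refine ⟨f0.comp A.continuous.continuousOn fun x hx => hx,
      fun z => df (A.prodMap A z), fun p hp v => HasDirDeriv.comp_clm A (f1 _ hp _), ?_⟩
    exact (ih f2 (A.prodMap A)).mono fun z hz => ⟨hz.1, mem_univ _⟩

/-- The difference quotients of a `C^1` map converge to the directional derivative locally uniformly
in the base point and the direction. -/
theorem IsCr.tendsto_quotient [LocallyConvexSpace ℝ F] {f : E → F} {U : Set E} (hf : IsCr 1 f U)
    (hU : IsOpen U) {p v : E} (hp : p ∈ U) {d : F} [T2Space F] (hd : HasDirDeriv f p v d) :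
    Tendsto (fun z : (E × E) × ℝ => z.2⁻¹ • (f (z.1.1 + z.2 • z.1.2) - f z.1.1))
      (𝓝 (p, v) ×ˢ 𝓝[≠] 0) (𝓝 d) := by
  obtain ⟨f0, df, f1, f2⟩ := hf
  obtain rfl : df (p, v) = d := (f1 p hp v).unique hd
  intro W' hW'
  obtain ⟨W, hW, hWc, hWcl, hWW⟩ := exists_closed_convex_nhds hW'
  have h2 : ContinuousAt df (p, v) :=
    ContinuousOn.continuousAt f2 ((hU.prod isOpen_univ).mem_nhds ⟨hp, mem_univ _⟩)
  have hev : ∀ᶠ z in 𝓝 (p, v), z.1 ∈ U ∧ df z ∈ W :=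
    (Eventually.mono ((hU.prod isOpen_univ).mem_nhds (⟨hp, mem_univ _⟩ : (p, v) ∈ U ×ˢ univ))
      fun z hz => hz.1).and (h2 hW)
  have key : ∀ᶠ z in 𝓝 ((p, v), (0 : ℝ)), ∀ s ∈ Icc (0 : ℝ) 1,
      z.1.1 + s • z.2 • z.1.2 ∈ U ∧ df (z.1.1 + s • z.2 • z.1.2, z.1.2) ∈ W := by
    refine isCompact_Icc.eventually_forall_of_forall_eventually (P := fun (z : (E × E) × ℝ) s =>
      z.1.1 + s • z.2 • z.1.2 ∈ U ∧ df (z.1.1 + s • z.2 • z.1.2, z.1.2) ∈ W) fun s _ => ?_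
    have hcont : Continuous fun y : ((E × E) × ℝ) × ℝ =>
        (y.1.1.1 + y.2 • y.1.2 • y.1.1.2, y.1.1.2) := by fun_prop
    have := hcont.tendsto (((p, v), 0), s)
    simp only [zero_smul, smul_zero, add_zero] at this
    exact this.eventually hev
  have hle : 𝓝 (p, v) ×ˢ 𝓝[≠] (0 : ℝ) ≤ 𝓝 ((p, v), (0 : ℝ)) := by
    rw [nhds_prod_eq (x := (p, v))]; exact Filter.prod_mono le_rfl nhdsWithin_le_nhds
  have hne : ∀ᶠ z : (E × E) × ℝ in 𝓝 (p, v) ×ˢ 𝓝[≠] (0 : ℝ), z.2 ≠ 0 :=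
    tendsto_snd.eventually (self_mem_nhdsWithin : ∀ᶠ t : ℝ in 𝓝[≠] 0, t ≠ 0)
  rw [Filter.mem_map]
  filter_upwards [hle key, hne] with z hz ht
  refine hWW ?_
  have := sub_mem_of_hasDirDeriv_mem (c := fun s : ℝ => z.2⁻¹ • f (z.1.1 + s • z.2 • z.1.2))
    (d := fun s => df (z.1.1 + s • z.2 • z.1.2, z.1.2)) hWc hWcl (fun s hs => ?_)
    (fun s hs => (hz s hs).2)
  · simpa [smul_sub] using this
  · have h3 := ((f1 _ (hz s hs).1 z.1.2).smul_dir z.2).line.clm_comp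
      (z.2⁻¹ • ContinuousLinearMap.id ℝ F)
    simpa [smul_smul, ht] using h3

theorem HasDirDeriv.comp [LocallyConvexSpace ℝ K] [T2Space K] {g : F → K} {V : Set F}
    (hg : IsCr 1 g V) (hV : IsOpen V) {f : E → F} {p v : E} {d : F} {d' : K} (hp : f p ∈ V)
    (hf : HasDirDeriv f p v d) (hd : HasDirDeriv g (f p) d d') :
    HasDirDeriv (fun x => g (f x)) p v d' := by
  have h1 := hg.tendsto_quotient hV hp hd
  have h2 : Tendsto (fun t : ℝ => ((f p, t⁻¹ • (f (p + t • v) - f p)), t)) (𝓝[≠] 0)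
      (𝓝 (f p, d) ×ˢ 𝓝[≠] 0) := by
    rw [nhds_prod_eq]
    exact (tendsto_const_nhds.prodMk hf).prodMk tendsto_id
  refine (h1.comp h2).congr' ?_
  filter_upwards [self_mem_nhdsWithin] with t ht
  have ht : t ≠ 0 := ht
  simp [smul_smul, ht]

theorem IsCr.comp [LocallyConvexSpace ℝ K] [T2Space K] [T2Space F] {n : ℕ} {g : F → K} {V : Set F}
    (hg : IsCr n g V) (hV : IsOpen V) {f : E → F} {U : Set E} (hf : IsCr n f U) (hU : IsOpen U)
    (hUV : MapsTo f U V) : IsCr n (fun x => g (f x)) U := by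
  induction n generalizing E F with
  | zero => exact ContinuousOn.comp hg hf hUV
  | succ n ih =>
    have hg1 : IsCr 1 g V := by
      clear ih hf
      induction n with
      | zero => exact hg
      | succ n ih => exact ih hg.of_succ
    have hfn := hf.of_succ
    obtain ⟨f0, df, f1, f2⟩ := hf
    obtain ⟨g0, dg, g1, g2⟩ := hg
    refine ⟨g0.comp f0 hUV, fun z => dg (f z.1, df z), fun p hp v =>
      HasDirDeriv.comp hg1 hV (hUV hp) (f1 p hp v) (g1 _ (hUV hp) _), ?_⟩
    have h1 : IsCr n (fun z : E × E => f z.1) (U ×ˢ univ) :=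
      (hfn.comp_clm (ContinuousLinearMap.fst ℝ E E)).mono fun z hz => hz.1
    exact ih g2 (hV.prod isOpen_univ) (h1.prodMk f2) (hU.prod isOpen_univ)
      fun z hz => ⟨hUV hz.1, mem_univ _⟩

end Cr

/-! ### Germs of smooth maps -/

section SmoothAt

variable {E : Type*} [AddCommGroup E] [Module ℝ E] [TopologicalSpace E]
  [IsTopologicalAddGroup E] [ContinuousSMul ℝ E] [LocallyConvexSpace ℝ E] [T2Space E]
  {F : Type*} [AddCommGroup F] [Module ℝ F] [TopologicalSpace F]
  [IsTopologicalAddGroup F] [ContinuousSMul ℝ F] [LocallyConvexSpace ℝ F] [T2Space F]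
  {K : Type*} [AddCommGroup K] [Module ℝ K] [TopologicalSpace K]
  [IsTopologicalAddGroup K] [ContinuousSMul ℝ K] [LocallyConvexSpace ℝ K] [T2Space K]

/-- `f` is smooth on some open neighbourhood of `p`. -/
def SmoothAt (f : E → F) (p : E) : Prop := ∃ U, IsOpen U ∧ p ∈ U ∧ SmoothOn f U

theorem SmoothOn.smoothAt {f : E → F} {U : Set E} (h : SmoothOn f U) (hU : IsOpen U) {p : E}
    (hp : p ∈ U) : SmoothAt f p := ⟨U, hU, hp, h⟩

theorem smoothOn_of_smoothAt {f : E → F} {U : Set E} (h : ∀ p ∈ U, SmoothAt f p) :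
    SmoothOn f U := fun n => isCr_of_local fun p hp => by
  obtain ⟨V, hV, hpV, hf⟩ := h p hp
  exact ⟨V, hV, hpV, hf n⟩

theorem SmoothAt.eventually {f : E → F} {p : E} (h : SmoothAt f p) :
    ∀ᶠ q in 𝓝 p, SmoothAt f q := by
  obtain ⟨U, hU, hp, hf⟩ := h
  filter_upwards [hU.mem_nhds hp] with q hq
  exact hf.smoothAt hU hq

theorem SmoothAt.congr {f g : E → F} {p : E} (h : SmoothAt f p) (hfg : f =ᶠ[𝓝 p] g) :
    SmoothAt g p := by
  obtain ⟨U, hU, hp, hf⟩ := h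
  obtain ⟨V, hVs, hV, hpV⟩ := mem_nhds_iff.1 hfg
  exact ⟨U ∩ V, hU.inter hV, ⟨hp, hpV⟩, fun n =>
    ((hf n).mono inter_subset_left).congr (hU.inter hV) fun x hx => hVs hx.2⟩

theorem SmoothAt.continuousAt {f : E → F} {p : E} (h : SmoothAt f p) : ContinuousAt f p := by
  obtain ⟨U, hU, hp, hf⟩ := h
  exact (hf 0).continuousOn.continuousAt (hU.mem_nhds hp)

theorem smoothAt_const (c : F) (p : E) : SmoothAt (fun _ : E => c) p :=
  ⟨univ, isOpen_univ, mem_univ _, fun n => isCr_const n c _⟩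

theorem smoothAt_clm (A : E →L[ℝ] F) (p : E) : SmoothAt A p :=
  ⟨univ, isOpen_univ, mem_univ _, fun n => isCr_clm n A _⟩

theorem smoothAt_id (p : E) : SmoothAt (fun x => x) p :=
  smoothAt_clm (ContinuousLinearMap.id ℝ E) p

theorem SmoothAt.prodMk {f : E → F} {g : E → K} {p : E} (hf : SmoothAt f p) (hg : SmoothAt g p) :
    SmoothAt (fun x => (f x, g x)) p := by
  obtain ⟨U, hU, hpU, hf⟩ := hf
  obtain ⟨V, hV, hpV, hg⟩ := hg
  exact ⟨U ∩ V, hU.inter hV, ⟨hpU, hpV⟩, fun n =>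
    ((hf n).mono inter_subset_left).prodMk ((hg n).mono inter_subset_right)⟩

theorem SmoothAt.comp {g : F → K} {f : E → F} {p : E} (hg : SmoothAt g (f p))
    (hf : SmoothAt f p) : SmoothAt (fun x => g (f x)) p := by
  obtain ⟨V, hV, hpV, hg⟩ := hg
  obtain ⟨U, hU, hpU, hf⟩ := hf
  have ho : IsOpen (U ∩ f ⁻¹' V) := (hf 0).continuousOn.isOpen_inter_preimage hU hV
  exact ⟨U ∩ f ⁻¹' V, ho, ⟨hpU, hpV⟩, fun n =>
    (hg n).comp hV ((hf n).mono inter_subset_left) ho fun x hx => hx.2⟩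

theorem SmoothAt.clm_comp {f : E → F} {p : E} (hf : SmoothAt f p) (A : F →L[ℝ] K) :
    SmoothAt (fun x => A (f x)) p := (smoothAt_clm A (f p)).comp hf

theorem smoothAt_fst (p : E × F) : SmoothAt (fun x : E × F => x.1) p :=
  smoothAt_clm (ContinuousLinearMap.fst ℝ E F) p

theorem smoothAt_snd (p : E × F) : SmoothAt (fun x : E × F => x.2) p :=
  smoothAt_clm (ContinuousLinearMap.snd ℝ E F) p

theorem SmoothAt.fst {f : E → F × K} {p : E} (hf : SmoothAt f p) :
    SmoothAt (fun x => (f x).1) p := (smoothAt_fst (f p)).comp hf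

theorem SmoothAt.snd {f : E → F × K} {p : E} (hf : SmoothAt f p) :
    SmoothAt (fun x => (f x).2) p := (smoothAt_snd (f p)).comp hf

theorem SmoothAt.add {f g : E → F} {p : E} (hf : SmoothAt f p) (hg : SmoothAt g p) :
    SmoothAt (fun x => f x + g x) p :=
  SmoothAt.clm_comp (f := fun x => (f x, g x)) (hf.prodMk hg)
    (ContinuousLinearMap.fst ℝ F F + ContinuousLinearMap.snd ℝ F F)

theorem SmoothAt.neg {f : E → F} {p : E} (hf : SmoothAt f p) :
    SmoothAt (fun x => - f x) p :=
  hf.clm_comp (-ContinuousLinearMap.id ℝ F)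

theorem SmoothAt.sub {f g : E → F} {p : E} (hf : SmoothAt f p) (hg : SmoothAt g p) :
    SmoothAt (fun x => f x - g x) p := by
  simpa [sub_eq_add_neg] using hf.add hg.neg

theorem SmoothAt.hasDirDeriv {f : E → F} {p : E} (hf : SmoothAt f p) (v : E) :
    HasDirDeriv f p v (dirDeriv f p v) := by
  obtain ⟨U, hU, hp, hf⟩ := hf
  exact ((isCr_succ_iff hU).1 (hf 1)).2.1 p hp v

/-- The differential of a smooth map is smooth as a map of base point and direction. -/
theorem SmoothAt.dirDeriv {f : E → F} {p : E} (hf : SmoothAt f p) (v : E) :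
    SmoothAt (fun z : E × E => dirDeriv f z.1 z.2) (p, v) := by
  obtain ⟨U, hU, hp, hf⟩ := hf
  exact ⟨U ×ˢ univ, hU.prod isOpen_univ, ⟨hp, mem_univ _⟩, fun n =>
    ((isCr_succ_iff hU).1 (hf (n + 1))).2.2⟩

theorem SmoothAt.hasDirDeriv_comp {g : F → K} {f : E → F} {p v : E} {d : F}
    (hg : SmoothAt g (f p)) (hf : HasDirDeriv f p v d) :
    HasDirDeriv (fun x => g (f x)) p v (LCLie.dirDeriv g (f p) d) := by
  obtain ⟨V, hV, hpV, h⟩ := hg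
  exact HasDirDeriv.comp (h 1) hV hpV hf (SmoothAt.hasDirDeriv ⟨V, hV, hpV, h⟩ d)

theorem SmoothAt.dirDeriv_comp {g : F → K} {f : E → F} {p : E}
    (hg : SmoothAt g (f p)) (hf : SmoothAt f p) (v : E) :
    LCLie.dirDeriv (fun x => g (f x)) p v = LCLie.dirDeriv g (f p) (LCLie.dirDeriv f p v) :=
  (hg.hasDirDeriv_comp (hf.hasDirDeriv v)).dirDeriv_eq

theorem SmoothAt.dirDeriv_apply {g : F → K} {a b : E → F} {p : E} (hg : SmoothAt g (a p))
    (ha : SmoothAt a p) (hb : SmoothAt b p) :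
    SmoothAt (fun x => LCLie.dirDeriv g (a x) (b x)) p :=
  SmoothAt.comp (g := fun z : F × F => LCLie.dirDeriv g z.1 z.2) (f := fun x => (a x, b x))
    (hg.dirDeriv (b p)) (ha.prodMk hb)

theorem dirDeriv_clm (A : E →L[ℝ] F) (p v : E) : dirDeriv A p v = A v :=
  (hasDirDeriv_clm A p v).dirDeriv_eq

theorem dirDeriv_id (p v : E) : dirDeriv (fun x : E => x) p v = v :=
  dirDeriv_clm (ContinuousLinearMap.id ℝ E) p v

theorem dirDeriv_const (c : F) (p v : E) : dirDeriv (fun _ : E => c) p v = 0 :=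
  (hasDirDeriv_const c p v).dirDeriv_eq

theorem SmoothAt.eventually_quotient {f : E → F} {p v : E} (hf : SmoothAt f p) {W : Set F}
    (hW : W ∈ 𝓝 (LCLie.dirDeriv f p v)) :
    ∀ᶠ z in 𝓝 ((p, v), (0 : ℝ)), z.2 ≠ 0 →
      z.2⁻¹ • (f (z.1.1 + z.2 • z.1.2) - f z.1.1) ∈ W := by
  obtain ⟨U, hU, hp, h⟩ := id hf
  have h1 := (h 1).tendsto_quotient hU hp (hf.hasDirDeriv v) hW
  rw [← nhdsWithin_univ (p, v), ← nhdsWithin_prod_eq, Filter.mem_map] at h1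
  have h2 := eventually_nhdsWithin_iff.1 h1
  filter_upwards [h2] with z hz ht
  exact hz ⟨mem_univ _, ht⟩

theorem SmoothAt.dirDeriv_add_dir {f : E → F} {p : E} (hf : SmoothAt f p) (v w : E) :
    LCLie.dirDeriv f p (v + w) = LCLie.dirDeriv f p v + LCLie.dirDeriv f p w := by
  obtain ⟨U, hU, hp, h⟩ := id hf
  have h1 := (h 1).tendsto_quotient hU hp (hf.hasDirDeriv w)
  have h2 : Tendsto (fun t : ℝ => ((p + t • v, w), t)) (𝓝[≠] 0) (𝓝 (p, w) ×ˢ 𝓝[≠] 0) := by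
    rw [nhds_prod_eq]
    exact (((tendsto_line p v).mono_left nhdsWithin_le_nhds).prodMk tendsto_const_nhds).prodMk
      tendsto_id
  refine HasDirDeriv.dirDeriv_eq ((Tendsto.add (hf.hasDirDeriv v) (h1.comp h2)).congr fun t => ?_)
  have e : p + t • v + t • w = p + t • (v + w) := by rw [smul_add, add_assoc]
  simp only [Function.comp, ← smul_add, e]
  rw [sub_add_sub_cancel']

theorem SmoothAt.dirDeriv_smul_dir {f : E → F} {p : E} (hf : SmoothAt f p) (c : ℝ) (v : E) :
    LCLie.dirDeriv f p (c • v) = c • LCLie.dirDeriv f p v :=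
  ((hf.hasDirDeriv v).smul_dir c).dirDeriv_eq

/-- The differential of a smooth map at a point, as a continuous linear map. -/
noncomputable def SmoothAt.deriv {f : E → F} {p : E} (hf : SmoothAt f p) : E →L[ℝ] F where
  toFun := LCLie.dirDeriv f p
  map_add' := hf.dirDeriv_add_dir
  map_smul' := hf.dirDeriv_smul_dir
  cont := continuous_iff_continuousAt.2 fun v =>
    ((hf.dirDeriv v).comp ((smoothAt_const p v).prodMk (smoothAt_id v))).continuousAt

theorem SmoothAt.deriv_apply {f : E → F} {p : E} (hf : SmoothAt f p) (v : E) :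
    hf.deriv v = LCLie.dirDeriv f p v := rfl

theorem SmoothAt.dirDeriv_prodMk {f : E → F} {g : E → K} {p : E} (hf : SmoothAt f p)
    (hg : SmoothAt g p) (v : E) : LCLie.dirDeriv (fun x => (f x, g x)) p v =
      (LCLie.dirDeriv f p v, LCLie.dirDeriv g p v) :=
  ((hf.hasDirDeriv v).prodMk (hg.hasDirDeriv v)).dirDeriv_eq

theorem SmoothAt.dirDeriv_clm_comp {f : E → F} {p : E} (hf : SmoothAt f p) (A : F →L[ℝ] K)
    (v : E) : LCLie.dirDeriv (fun x => A (f x)) p v = A (LCLie.dirDeriv f p v) :=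
  ((hf.hasDirDeriv v).clm_comp A).dirDeriv_eq

theorem SmoothAt.partial_left {f : E × F → K} {x : E} {y : F} (hf : SmoothAt f (x, y)) :
    SmoothAt (fun x' => f (x', y)) x :=
  SmoothAt.comp (f := fun x' => (x', y)) hf ((smoothAt_id x).prodMk (smoothAt_const y x))

theorem SmoothAt.partial_right {f : E × F → K} {x : E} {y : F} (hf : SmoothAt f (x, y)) :
    SmoothAt (fun y' => f (x, y')) y :=
  SmoothAt.comp (f := fun y' => (x, y')) hf ((smoothAt_const x y).prodMk (smoothAt_id y))

theorem SmoothAt.dirDeriv_left {f : E × F → K} {x : E} {y : F} (hf : SmoothAt f (x, y)) (v : E) :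
    LCLie.dirDeriv f (x, y) (v, 0) = LCLie.dirDeriv (fun x' => f (x', y)) x v :=
  ((hf.hasDirDeriv_comp (f := fun x' => (x', y))
    (((smoothAt_id x).hasDirDeriv v).prodMk (hasDirDeriv_const y x v))).dirDeriv_eq.trans
      (by rw [dirDeriv_id])).symm

theorem SmoothAt.dirDeriv_right {f : E × F → K} {x : E} {y : F} (hf : SmoothAt f (x, y)) (w : F) :
    LCLie.dirDeriv f (x, y) (0, w) = LCLie.dirDeriv (fun y' => f (x, y')) y w :=
  ((hf.hasDirDeriv_comp (f := fun y' => (x, y'))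
    ((hasDirDeriv_const x y w).prodMk ((smoothAt_id y).hasDirDeriv w))).dirDeriv_eq.trans
      (by rw [dirDeriv_id])).symm

theorem SmoothAt.dirDeriv_split {f : E × F → K} {x : E} {y : F} (hf : SmoothAt f (x, y))
    (v : E) (w : F) : LCLie.dirDeriv f (x, y) (v, w) =
      LCLie.dirDeriv (fun x' => f (x', y)) x v + LCLie.dirDeriv (fun y' => f (x, y')) y w := by
  rw [← hf.dirDeriv_left, ← hf.dirDeriv_right, ← hf.dirDeriv_add_dir]
  simp

/-- Second-order difference quotients converge to the iterated derivative. -/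
theorem SmoothAt.tendsto_second_quotient {f : E → F} {p : E} (hf : SmoothAt f p) (v w : E) :
    Tendsto (fun t : ℝ => (t * t)⁻¹ • (f (p + t • v + t • w) - f (p + t • v) - (f (p + t • w) - f p)))
      (𝓝[≠] 0) (𝓝 (LCLie.dirDeriv (fun q => LCLie.dirDeriv f q v) p w)) := by
  intro W' hW'
  obtain ⟨W, hW, hWc, hWcl, hWW⟩ := exists_closed_convex_nhds hW'
  have hg : SmoothAt (fun q => LCLie.dirDeriv f q v) p :=
    SmoothAt.comp (f := fun q => (q, v)) (hf.dirDeriv v)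
      ((smoothAt_id p).prodMk (smoothAt_const v p))
  have h1 := hg.eventually_quotient hW
  have h2 : ∀ᶠ z : ℝ × ℝ in 𝓝 (0, 0), SmoothAt f (p + z.1 • v + z.2 • w) := by
    have hc : Continuous fun z : ℝ × ℝ => p + z.1 • v + z.2 • w := by fun_prop
    have := hc.tendsto (0, 0)
    simp only [zero_smul, add_zero] at this
    exact this.eventually hf.eventually
  have key : ∀ᶠ t in 𝓝 (0 : ℝ), ∀ s ∈ Icc (0 : ℝ) 1,
      (t ≠ 0 → t⁻¹ • (LCLie.dirDeriv f (p + (s * t) • v + t • w) v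
        - LCLie.dirDeriv f (p + (s * t) • v) v) ∈ W) ∧
      SmoothAt f (p + (s * t) • v + t • w) ∧ SmoothAt f (p + (s * t) • v) := by
    refine isCompact_Icc.eventually_forall_of_forall_eventually (P := fun (t : ℝ) s =>
      (t ≠ 0 → t⁻¹ • (LCLie.dirDeriv f (p + (s * t) • v + t • w) v
        - LCLie.dirDeriv f (p + (s * t) • v) v) ∈ W) ∧
      SmoothAt f (p + (s * t) • v + t • w) ∧ SmoothAt f (p + (s * t) • v)) fun s _ => ?_
    have c1 : Continuous fun y : ℝ × ℝ => ((p + (y.2 * y.1) • v, w), y.1) := by fun_prop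
    have c2 : Continuous fun y : ℝ × ℝ => (y.2 * y.1, y.1) := by fun_prop
    have c3 : Continuous fun y : ℝ × ℝ => (y.2 * y.1, (0 : ℝ)) := by fun_prop
    have t1 := c1.tendsto (0, s)
    have t2 := c2.tendsto (0, s)
    have t3 := c3.tendsto (0, s)
    simp only [mul_zero, zero_smul, add_zero] at t1 t2 t3
    filter_upwards [t1.eventually h1, t2.eventually h2, t3.eventually h2] with y a1 a2 a3
    exact ⟨a1, a2, by simpa using a3⟩
  rw [Filter.mem_map]
  filter_upwards [nhdsWithin_le_nhds key, self_mem_nhdsWithin] with t ht ht0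
  have ht0 : t ≠ 0 := ht0
  refine hWW ?_
  have := sub_mem_of_hasDirDeriv_mem
    (c := fun s : ℝ => (t * t)⁻¹ • (f (p + (s * t) • v + t • w) - f (p + (s * t) • v)))
    (d := fun s => t⁻¹ • (LCLie.dirDeriv f (p + (s * t) • v + t • w) v
        - LCLie.dirDeriv f (p + (s * t) • v) v)) hWc hWcl (fun s hs => ?_)
    (fun s hs => (ht s hs).1 ht0)
  · simpa [smul_sub] using this
  · have b1 : HasDirDeriv (fun s : ℝ => p + (s * t) • v) s 1 (t • v) := by
      have := (hasDirDeriv_const p s (1 : ℝ)).add (hasDirDeriv_clm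
        ((ContinuousLinearMap.id ℝ ℝ).smulRight (t • v)) s 1)
      simpa only [ContinuousLinearMap.smulRight_apply, ContinuousLinearMap.id_apply, smul_smul,
        zero_add, one_mul] using this
    have b2 : HasDirDeriv (fun s : ℝ => p + (s * t) • v + t • w) s 1 (t • v) := by
      simpa using b1.add (hasDirDeriv_const (t • w) s (1 : ℝ))
    have b3 := SmoothAt.hasDirDeriv_comp (f := fun s : ℝ => p + (s * t) • v + t • w)
      (ht s hs).2.1 b2
    have b4 := SmoothAt.hasDirDeriv_comp (f := fun s : ℝ => p + (s * t) • v) (ht s hs).2.2 b1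
    rw [(ht s hs).2.1.dirDeriv_smul_dir] at b3
    rw [(ht s hs).2.2.dirDeriv_smul_dir] at b4
    have b5 : HasDirDeriv (fun s : ℝ => f (p + (s * t) • v + t • w) - f (p + (s * t) • v)) s 1 (t •
        (LCLie.dirDeriv f (p + (s * t) • v + t • w) v
          - LCLie.dirDeriv f (p + (s * t) • v) v)) := by
      rw [smul_sub]
      exact HasDirDeriv.sub b3 b4
    have b6 : HasDirDeriv (fun s : ℝ => (t * t)⁻¹ •
        (f (p + (s * t) • v + t • w) - f (p + (s * t) • v))) s 1 ((t * t)⁻¹ • t •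
        (LCLie.dirDeriv f (p + (s * t) • v + t • w) v - LCLie.dirDeriv f (p + (s * t) • v) v)) :=
      HasDirDeriv.const_smul b5 _
    have e : (t * t)⁻¹ * t = t⁻¹ := by field_simp
    rwa [smul_smul, e] at b6

/-- **Schwarz's theorem**: second directional derivatives commute. -/
theorem SmoothAt.dirDeriv_comm {f : E → F} {p : E} (hf : SmoothAt f p) (v w : E) :
    LCLie.dirDeriv (fun q => LCLie.dirDeriv f q v) p w =
      LCLie.dirDeriv (fun q => LCLie.dirDeriv f q w) p v := by
  refine tendsto_nhds_unique (hf.tendsto_second_quotient v w)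
    ((hf.tendsto_second_quotient w v).congr fun t => ?_)
  rw [add_right_comm]
  congr 1
  exact sub_sub_sub_comm _ _ _ _

end SmoothAt

/-! ### An implicit function theorem with parameters in a locally convex space -/

section Implicit

universe u v

variable {Z : Type*} [AddCommGroup Z] [Module ℝ Z] [TopologicalSpace Z]
  [IsTopologicalAddGroup Z] [ContinuousSMul ℝ Z] [LocallyConvexSpace ℝ Z] [T2Space Z]
  {P : Type v} [AddCommGroup P] [Module ℝ P] [TopologicalSpace P]
  [IsTopologicalAddGroup P] [ContinuousSMul ℝ P] [LocallyConvexSpace ℝ P] [T2Space P]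
  {B : Type u} [NormedAddCommGroup B] [NormedSpace ℝ B]
  {B' : Type*} [NormedAddCommGroup B'] [NormedSpace ℝ B']

/-- A smooth family of homogeneous maps between normed spaces, with parameter in a locally convex
space, is continuous in the parameter for the operator norm. -/
theorem SmoothAt.eventually_norm_sub_le {T : Z × B → B'} {z₀ : Z} (hT : SmoothAt T (z₀, 0))
    (hlin : ∀ᶠ z in 𝓝 z₀, ∀ (c : ℝ) b, T (z, c • b) = c • T (z, b)) {ε : ℝ} (hε : 0 < ε) :
    ∀ᶠ z in 𝓝 z₀, ∀ b, ‖T (z, b) - T (z₀, b)‖ ≤ ε * ‖b‖ := by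
  have h1 : SmoothAt (fun y : (Z × Z) × B => LCLie.dirDeriv T (y.1.1, y.2) (y.1.2, 0))
      ((z₀, 0), 0) :=
    SmoothAt.dirDeriv_apply (a := fun y : (Z × Z) × B => (y.1.1, y.2))
      (b := fun y : (Z × Z) × B => (y.1.2, (0 : B))) hT
      ((smoothAt_fst _).fst.prodMk (smoothAt_snd _))
        ((smoothAt_fst _).snd.prodMk (smoothAt_const _ _))
  have h2 : ∀ᶠ y : (Z × Z) × B in 𝓝 ((z₀, 0), 0), SmoothAt T (y.1.1, y.2) ∧
      ‖LCLie.dirDeriv T (y.1.1, y.2) (y.1.2, 0)‖ < 1 := by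
    have hc : Continuous fun y : (Z × Z) × B => (y.1.1, y.2) := by fun_prop
    refine ((hc.tendsto ((z₀, 0), 0)).eventually hT.eventually).and
      (h1.continuousAt.norm.eventually_lt continuousAt_const ?_)
    have := hT.deriv.map_zero
    rw [hT.deriv_apply] at this
    simp [← Prod.zero_eq_mk, this]
  rw [nhds_prod_eq] at h2
  obtain ⟨pa, hpa, δ', hδ', hP⟩ := Metric.eventually_prod_nhds_iff.1 h2
  set δ := δ' / 2 with hδdef
  have hδ : 0 < δ := by positivity
  have hlt : δ < δ' := by rw [hδdef]; linarith
  have h3 : ∀ᶠ z in 𝓝 z₀, ∀ s ∈ Icc (0 : ℝ) 1, pa (z₀ + s • (z - z₀), (ε * δ)⁻¹ • (z - z₀)) := by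
    refine isCompact_Icc.eventually_forall_of_forall_eventually
      (P := fun z s => pa (z₀ + s • (z - z₀), (ε * δ)⁻¹ • (z - z₀))) fun s _ => ?_
    have hc : Continuous fun y : Z × ℝ =>
      (z₀ + y.2 • (y.1 - z₀), (ε * δ)⁻¹ • (y.1 - z₀)) := by fun_prop
    have := hc.tendsto (z₀, s)
    simp only [sub_self, smul_zero, add_zero] at this
    exact this.eventually hpa
  filter_upwards [h3, hlin] with z hz hl
  have hl0 := hlin.self_of_nhds
  have hsmall : ∀ b : B, ‖b‖ ≤ δ → ‖T (z, b) - T (z₀, b)‖ ≤ ε * δ := fun b hb => by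
    have hb' : dist b 0 < δ' := by rw [dist_zero_right]; linarith
    have := sub_mem_of_hasDirDeriv_mem (c := fun s : ℝ => T (z₀ + s • (z - z₀), b))
      (d := fun s => LCLie.dirDeriv T (z₀ + s • (z - z₀), b) (z - z₀, 0))
      (convex_closedBall (0 : B') (ε * δ)) Metric.isClosed_closedBall (fun s hs => ?_)
      (fun s hs => ?_)
    · simpa using this
    · have hsm := (hP (hz s hs) hb').1
      have e : (z₀ + s • (z - z₀), b) = ((z₀, b) : Z × B) + s • ((z - z₀, 0) : Z × B) := by simp
      have h4 := hsm.hasDirDeriv (z - z₀, 0)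
      rw [e] at h4
      simpa using h4.line
    · have h5 := hP (hz s hs) hb'
      have e : ((z - z₀, 0) : Z × B) = (ε * δ) • ((ε * δ)⁻¹ • (z - z₀), (0 : B)) := by
        have : ε * δ ≠ 0 := by positivity
        rw [Prod.smul_mk, smul_smul, mul_inv_cancel₀ this, one_smul, smul_zero]
      rw [mem_closedBall_zero_iff, e, h5.1.dirDeriv_smul_dir, norm_smul, Real.norm_eq_abs,
        abs_of_pos (by positivity)]
      have := h5.2.le
      exact mul_le_of_le_one_right (by positivity) this
  intro b
  rcases eq_or_ne b 0 with rfl | hb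
  · have a1 := hl 0 0
    have a2 := hl0 0 0
    simp only [zero_smul] at a1 a2
    simp [a1, a2]
  · have hb : 0 < ‖b‖ := norm_pos_iff.2 hb
    have h6 := hsmall ((δ / ‖b‖) • b) (by
      rw [norm_smul, Real.norm_eq_abs, abs_of_pos (by positivity)]; field_simp; rfl)
    rw [hl, hl0, ← smul_sub, norm_smul, Real.norm_eq_abs, abs_of_pos (by positivity)] at h6
    have h7 : δ / ‖b‖ * ‖T (z, b) - T (z₀, b)‖ ≤ δ / ‖b‖ * (ε * ‖b‖) := by
      refine h6.trans (le_of_eq ?_)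
      field_simp
    exact le_of_mul_le_mul_left h7 (by positivity)

theorem SmoothAt.eventually_norm_dirDeriv_sub_le {F : B × P → B'} {z₀ : B × P}
    (hF : SmoothAt F z₀) {ε : ℝ} (hε : 0 < ε) :
    ∀ᶠ z in 𝓝 z₀, ∀ b, ‖LCLie.dirDeriv F z (b, 0) - LCLie.dirDeriv F z₀ (b, 0)‖ ≤ ε * ‖b‖ := by
  refine SmoothAt.eventually_norm_sub_le (T := fun y : (B × P) × B => LCLie.dirDeriv F y.1 (y.2, 0))
    ?_ ?_ hε
  · exact SmoothAt.dirDeriv_apply (a := fun y : (B × P) × B => y.1)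
      (b := fun y : (B × P) × B => (y.2, (0 : P))) hF
      (smoothAt_fst _) ((smoothAt_snd _).prodMk (smoothAt_const _ _))
  · filter_upwards [hF.eventually] with z hz c b
    rw [← hz.dirDeriv_smul_dir]
    simp

/-- Strict differentiability in the normed variable, locally uniformly in the parameter. -/
theorem SmoothAt.eventually_strict {F : B × P → B'} {x₀ : B} {p₀ : P}
    (hF : SmoothAt F (x₀, p₀)) {ε : ℝ} (hε : 0 < ε) :
    ∀ᶠ q : (B × B) × P in 𝓝 ((x₀, x₀), p₀),
      ‖F (q.1.1, q.2) - F (q.1.2, q.2) - LCLie.dirDeriv F (x₀, p₀) (q.1.1 - q.1.2, 0)‖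
        ≤ ε * ‖q.1.1 - q.1.2‖ := by
  have h1 := (hF.eventually_norm_dirDeriv_sub_le hε).and hF.eventually
  have h2 : ∀ᶠ q : (B × B) × P in 𝓝 ((x₀, x₀), p₀), ∀ s ∈ Icc (0 : ℝ) 1,
      (∀ b, ‖LCLie.dirDeriv F (q.1.2 + s • (q.1.1 - q.1.2), q.2) (b, 0)
        - LCLie.dirDeriv F (x₀, p₀) (b, 0)‖ ≤ ε * ‖b‖) ∧
      SmoothAt F (q.1.2 + s • (q.1.1 - q.1.2), q.2) := by
    refine isCompact_Icc.eventually_forall_of_forall_eventually (P := fun (q : (B × B) × P) s =>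
      (∀ b, ‖LCLie.dirDeriv F (q.1.2 + s • (q.1.1 - q.1.2), q.2) (b, 0)
        - LCLie.dirDeriv F (x₀, p₀) (b, 0)‖ ≤ ε * ‖b‖) ∧
      SmoothAt F (q.1.2 + s • (q.1.1 - q.1.2), q.2)) fun s _ => ?_
    have hc : Continuous fun y : ((B × B) × P) × ℝ =>
      (y.1.1.2 + y.2 • (y.1.1.1 - y.1.1.2), y.1.2) := by fun_prop
    have := hc.tendsto (((x₀, x₀), p₀), s)
    simp only [sub_self, smul_zero, add_zero] at this
    exact this.eventually h1
  filter_upwards [h2] with q hq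
  obtain ⟨⟨x, x'⟩, p⟩ := q
  simp only at hq ⊢
  have := sub_mem_of_hasDirDeriv_mem
    (c := fun s : ℝ => F (x' + s • (x - x'), p) - s • LCLie.dirDeriv F (x₀, p₀) (x - x', 0))
    (d := fun s => LCLie.dirDeriv F (x' + s • (x - x'), p) (x - x', 0)
      - LCLie.dirDeriv F (x₀, p₀) (x - x', 0))
    (convex_closedBall (0 : B') (ε * ‖x - x'‖)) Metric.isClosed_closedBall (fun s hs => ?_)
    (fun s hs => ?_)
  · have e : F (x, p) - LCLie.dirDeriv F (x₀, p₀) (x - x', 0) - F (x', p)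
        = F (x, p) - F (x', p) - LCLie.dirDeriv F (x₀, p₀) (x - x', 0) := by abel
    simpa [e] using this
  · have h3 := hasDirDeriv_clm ((ContinuousLinearMap.id ℝ ℝ).smulRight
      (LCLie.dirDeriv F (x₀, p₀) (x - x', 0))) s 1
    rw [ContinuousLinearMap.smulRight_apply, ContinuousLinearMap.id_apply, one_smul] at h3
    refine HasDirDeriv.sub ?_ h3
    · have e : (x' + s • (x - x'), p) = ((x', p) : B × P) + s • ((x - x', 0) : B × P) := by simp
      have h4 := (hq s hs).2.hasDirDeriv (x - x', 0)
      rw [e] at h4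
      simpa using h4.line
  · simpa using (hq s hs).1 (x - x')

/-- The tangent map `(F, dF)` of a map on a product, with the base points and directions of each
factor grouped together. -/
noncomputable def prodTangent (F : B × P → B') (w : (B × B) × (P × P)) : B' × B' :=
  (F (w.1.1, w.2.1), dirDeriv F (w.1.1, w.2.1) (w.1.2, w.2.2))

/-- A continuous solution of an implicit equation is differentiable. -/
theorem hasDirDeriv_implicit {F : B × P → B} {x : P → B} {p : P} (hx : ContinuousAt x p)
    (hF : SmoothAt F (x p, p)) (h0 : ∀ᶠ q in 𝓝 p, F (x q, q) = 0) {J : B →L[ℝ] B}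
    (hJ : ∀ b, J (dirDeriv F (x p, p) (b, 0)) = b) (η : P) :
    HasDirDeriv x p η (-J (dirDeriv F (x p, p) (0, η))) := by
  set Δ : ℝ → B := fun t => x (p + t • η) - x p
  set R : ℝ → B := fun t => F (x p, p + t • η)
  have hline := tendsto_line p η
  have h00 := h0.self_of_nhds
  have hR : Tendsto (fun t : ℝ => t⁻¹ • R t) (𝓝[≠] 0) (𝓝 (dirDeriv F (x p, p) (0, η))) := by
    have := hF.hasDirDeriv (0, η)
    unfold HasDirDeriv at this
    simpa [h00] using this
  have h1 : (fun t => -J (R t) - Δ t) =o[𝓝[≠] 0] Δ := by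
    refine Asymptotics.isLittleO_iff.2 fun c hc => ?_
    have hε : 0 < c / (‖J‖ + 1) := by positivity
    have hst := hF.eventually_strict hε
    have ht : Tendsto (fun t : ℝ => ((x (p + t • η), x p), p + t • η)) (𝓝 0)
        (𝓝 ((x p, x p), p)) :=
      ((hx.tendsto.comp hline).prodMk_nhds tendsto_const_nhds).prodMk_nhds hline
    filter_upwards [nhdsWithin_le_nhds (ht.eventually hst),
      nhdsWithin_le_nhds (hline.eventually h0)] with t h2 h3
    simp only [h3, zero_sub] at h2
    have e : -J (R t) - Δ t = J (-R t - dirDeriv F (x p, p) (Δ t, 0)) := by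
      rw [map_sub, hJ, map_neg]
    rw [e]
    calc ‖J (-R t - dirDeriv F (x p, p) (Δ t, 0))‖ ≤ ‖J‖ * (c / (‖J‖ + 1) * ‖Δ t‖) :=
          J.le_opNorm_of_le h2
      _ = ‖J‖ / (‖J‖ + 1) * (c * ‖Δ t‖) := by ring
      _ ≤ 1 * (c * ‖Δ t‖) := by
          gcongr
          rw [div_le_one (by positivity)]
          linarith
      _ = c * ‖Δ t‖ := one_mul _
  -- asymptotic equivalence is symmetric, so the error is also small relative to `J (R t) = O(t)`
  have h2 : (fun t => Δ t - -J (R t)) =o[𝓝[≠] 0] (fun t => -J (R t)) :=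
    Asymptotics.IsEquivalent.symm (u := fun t => -J (R t)) (v := Δ) h1
  have hJR : Tendsto (fun t : ℝ => t⁻¹ • (-J (R t))) (𝓝[≠] 0)
      (𝓝 (-J (dirDeriv F (x p, p) (0, η)))) := by
    refine ((J.continuous.tendsto _).comp hR).neg.congr fun t => ?_
    simp
  have h3 : (fun t => -J (R t)) =O[𝓝[≠] 0] (fun t : ℝ => t) := by
    have := (hJR.isBigO_one ℝ)
    have h4 := (Asymptotics.isBigO_refl (fun t : ℝ => t) (𝓝[≠] 0)).smul this
    refine (h4.congr' ?_ ?_)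
    · filter_upwards [self_mem_nhdsWithin] with t ht
      have ht : t ≠ 0 := ht
      simp [smul_smul, ht]
    · exact Eventually.of_forall fun t => by simp
  have h5 := (h2.trans_isBigO h3).tendsto_inv_smul_nhds_zero
  have h6 := h5.add hJR
  rw [zero_add] at h6
  refine h6.congr fun t => ?_
  rw [← smul_add]
  simp [Δ]

theorem dirDeriv_prodTangent {F : B × P → B'} {x ξ : B} {p η : P} (hF : SmoothAt F (x, p))
    (b c : B) :
    dirDeriv (prodTangent F) ((x, ξ), (p, η)) ((b, c), 0) =
      (dirDeriv F (x, p) (b, 0),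
        dirDeriv (fun z : (B × P) × (B × P) => dirDeriv F z.1 z.2) ((x, p), (ξ, η)) ((b, 0), 0)
          + dirDeriv F (x, p) (c, 0)) := by
  have h1 : SmoothAt (fun w : (B × B) × (P × P) => (w.1.1, w.2.1)) ((x, ξ), (p, η)) :=
    (smoothAt_fst _).fst.prodMk (smoothAt_snd _).fst
  have h2 : SmoothAt (fun w : (B × B) × (P × P) => (w.1.2, w.2.2)) ((x, ξ), (p, η)) :=
    (smoothAt_fst _).snd.prodMk (smoothAt_snd _).snd
  have d1 : HasDirDeriv (fun w : (B × B) × (P × P) => (w.1.1, w.2.1)) ((x, ξ), (p, η)) ((b, c), 0)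
      (b, 0) := hasDirDeriv_clm (((ContinuousLinearMap.fst ℝ B B).comp
        (ContinuousLinearMap.fst ℝ _ _)).prod ((ContinuousLinearMap.fst ℝ P P).comp
        (ContinuousLinearMap.snd ℝ _ _))) _ _
  have d2 : HasDirDeriv (fun w : (B × B) × (P × P) => (w.1.2, w.2.2)) ((x, ξ), (p, η)) ((b, c), 0)
      (c, 0) := hasDirDeriv_clm (((ContinuousLinearMap.snd ℝ B B).comp
        (ContinuousLinearMap.fst ℝ _ _)).prod ((ContinuousLinearMap.snd ℝ P P).comp
        (ContinuousLinearMap.snd ℝ _ _))) _ _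
  have e1 := SmoothAt.hasDirDeriv_comp (f := fun w : (B × B) × (P × P) => (w.1.1, w.2.1)) hF d1
  have hdF := hF.dirDeriv (ξ, η)
  have e2 := SmoothAt.hasDirDeriv_comp
    (f := fun w : (B × B) × (P × P) => ((w.1.1, w.2.1), (w.1.2, w.2.2))) hdF (d1.prodMk d2)
  refine (e1.prodMk e2).dirDeriv_eq.trans ?_
  have e3 : (((b, 0), (c, 0)) : (B × P) × (B × P)) = ((b, 0), 0) + (0, (c, 0)) := by simp
  rw [e3, hdF.dirDeriv_add_dir, hdF.dirDeriv_right]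
  have e4 := dirDeriv_clm hF.deriv (ξ, η) (c, 0)
  have e5 : dirDeriv (fun y' => dirDeriv F (x, p) y') (ξ, η) (c, 0) = dirDeriv F (x, p) (c, 0) := e4
  simp only [e5]

/-- A continuous solution of a smooth implicit equation is of class `C^n`. The induction applies the
statement for `n` to the equation `(F, dF) = 0`, which is solved by the solution together with its
differential. -/
theorem isCr_implicit (n : ℕ) {F : B × P → B} {x : P → B} {U : Set P} (hU : IsOpen U)
    (hx : ContinuousOn x U) (hF : ∀ p ∈ U, SmoothAt F (x p, p)) (h0 : ∀ p ∈ U, F (x p, p) = 0)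
    (hJ : ∀ p ∈ U, ∃ J : B →L[ℝ] B, ∀ b, J (dirDeriv F (x p, p) (b, 0)) = b) : IsCr n x U := by
  induction n generalizing B P with
  | zero => exact hx
  | succ n ih =>
    have hxc : ∀ p ∈ U, ContinuousAt x p := fun p hp => hx.continuousAt (hU.mem_nhds hp)
    have h0e : ∀ p ∈ U, ∀ᶠ q in 𝓝 p, F (x q, q) = 0 := fun p hp => by
      filter_upwards [hU.mem_nhds hp] with q hq using h0 q hq
    have hd : ∀ p ∈ U, ∀ η, HasDirDeriv x p η (dirDeriv x p η) := fun p hp η => by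
      obtain ⟨J, hJ⟩ := hJ p hp
      have := hasDirDeriv_implicit (hxc p hp) (hF p hp) (h0e p hp) hJ η
      rwa [this.dirDeriv_eq]
    have heq : ∀ p ∈ U, ∀ η, dirDeriv F (x p, p) (dirDeriv x p η, η) = 0 := fun p hp η => by
      have h1 := SmoothAt.hasDirDeriv_comp (f := fun q => (x q, q)) (hF p hp)
        ((hd p hp η).prodMk ((smoothAt_id p).hasDirDeriv η))
      rw [dirDeriv_id] at h1
      exact (h1.congr (h0e p hp)).unique (hasDirDeriv_const 0 p η)
    have hcont : ContinuousOn (fun z : P × P => dirDeriv x z.1 z.2) (U ×ˢ univ) := by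
      rintro ⟨p₀, η₀⟩ ⟨hp₀ : p₀ ∈ U, -⟩
      refine ContinuousAt.continuousWithinAt ?_
      obtain ⟨J, hJ⟩ := hJ p₀ hp₀
      set q₀ := dirDeriv x p₀ η₀ with hq₀
      have hε : 0 < 1 / (2 * (‖J‖ + 1)) := by positivity
      have hxp : ContinuousAt (fun z : P × P => (x z.1, z.1)) (p₀, η₀) :=
        ContinuousAt.prodMk (ContinuousAt.comp (f := Prod.fst) (hxc p₀ hp₀) continuousAt_fst)
          continuousAt_fst
      have hest := hxp.tendsto.eventually ((hF p₀ hp₀).eventually_norm_dirDeriv_sub_le hε)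
      have hlim : Tendsto (fun z : P × P => 2 * ‖J‖ * ‖dirDeriv F (x z.1, z.1) (q₀, z.2)‖)
          (𝓝 (p₀, η₀)) (𝓝 0) := by
        have c1 : ContinuousAt (fun z : P × P => ((x z.1, z.1), (q₀, z.2))) (p₀, η₀) :=
          hxp.prodMk (continuousAt_const.prodMk continuousAt_snd)
        have c2 := ContinuousAt.comp (f := fun z : P × P => ((x z.1, z.1), (q₀, z.2)))
          ((hF p₀ hp₀).dirDeriv (q₀, η₀)).continuousAt c1
        have c3 := (c2.norm.tendsto).const_mul (2 * ‖J‖)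
        simpa [hq₀, heq p₀ hp₀ η₀, Function.comp_def] using c3
      have hUe : ∀ᶠ z : P × P in 𝓝 (p₀, η₀), z.1 ∈ U :=
        continuousAt_fst.eventually (hU.mem_nhds hp₀)
      refine tendsto_iff_norm_sub_tendsto_zero.2 (squeeze_zero' (Eventually.of_forall fun _ =>
        norm_nonneg _) ?_ hlim)
      filter_upwards [hest, hUe] with z hz hzU
      set d := dirDeriv x z.1 z.2 - q₀ with hd'
      have hA : dirDeriv F (x z.1, z.1) (d, 0) = - dirDeriv F (x z.1, z.1) (q₀, z.2) := by
        have e : ((d, 0) : B × P) = (dirDeriv x z.1 z.2, z.2) + (-1 : ℝ) • (q₀, z.2) := by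
          simp [hd', sub_eq_add_neg]
        rw [e, (hF _ hzU).dirDeriv_add_dir, heq _ hzU, (hF _ hzU).dirDeriv_smul_dir]
        simp
      have h1 : ‖d‖ ≤ ‖J‖ * (‖dirDeriv F (x z.1, z.1) (d, 0)‖ + 1 / (2 * (‖J‖ + 1)) * ‖d‖) := by
        conv_lhs => rw [← hJ d]
        refine J.le_opNorm_of_le ?_
        have := hz d
        rw [norm_sub_rev] at this
        exact (norm_le_norm_add_norm_sub' _ _).trans (add_le_add_right this _)
      have h2 : ‖J‖ * (1 / (2 * (‖J‖ + 1)) * ‖d‖) ≤ 1 / 2 * ‖d‖ := by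
        rw [← mul_assoc]
        gcongr
        rw [mul_one_div, div_le_div_iff₀ (by positivity) (by positivity)]
        linarith [norm_nonneg J]
      rw [hA, norm_neg, mul_add] at h1
      linarith
    refine (isCr_succ_iff hU).2 ⟨hx, hd, ?_⟩
    have hT := ih (F := prodTangent F) (x := fun z : P × P => (x z.1, dirDeriv x z.1 z.2))
      (U := U ×ˢ univ) (hU.prod isOpen_univ)
      ((hx.comp continuousOn_fst fun z hz => hz.1).prodMk hcont) ?_ ?_ ?_
    · exact (isCr_clm n (ContinuousLinearMap.snd ℝ B B) univ).comp isOpen_univ hT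
        (hU.prod isOpen_univ) fun _ _ => mem_univ _
    · rintro ⟨p, η⟩ ⟨hp : p ∈ U, -⟩
      have h1 : SmoothAt (fun w : (B × B) × (P × P) => (w.1.1, w.2.1))
          ((x p, dirDeriv x p η), (p, η)) :=
        (smoothAt_fst _).fst.prodMk (smoothAt_snd _).fst
      have h2 : SmoothAt (fun w : (B × B) × (P × P) => (w.1.2, w.2.2))
          ((x p, dirDeriv x p η), (p, η)) :=
        (smoothAt_fst _).snd.prodMk (smoothAt_snd _).snd
      exact (SmoothAt.comp (f := fun w : (B × B) × (P × P) => (w.1.1, w.2.1)) (hF p hp) h1).prodMk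
        (SmoothAt.dirDeriv_apply (a := fun w : (B × B) × (P × P) => (w.1.1, w.2.1)) (hF p hp) h1 h2)
    · rintro ⟨p, η⟩ ⟨hp : p ∈ U, -⟩
      exact Prod.ext (h0 p hp) (heq p hp η)
    · rintro ⟨p, η⟩ ⟨hp : p ∈ U, -⟩
      obtain ⟨J, hJ⟩ := hJ p hp
      -- the partial derivative of the tangent map is `[[A, 0], [M, A]]` with `A` that of `F`,
      -- so a left inverse of `A` yields one of this matrix
      let M : B →L[ℝ] B := ((hF p hp).dirDeriv (dirDeriv x p η, η)).deriv.comp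
        ((ContinuousLinearMap.inl ℝ _ _).comp (ContinuousLinearMap.inl ℝ B P))
      let J₁ : B × B →L[ℝ] B := J.comp (ContinuousLinearMap.fst ℝ B B)
      refine ⟨J₁.prod (J.comp (ContinuousLinearMap.snd ℝ B B - M.comp J₁)), ?_⟩
      rintro ⟨b, c⟩
      have hM : dirDeriv (fun z : (B × P) × (B × P) => dirDeriv F z.1 z.2)
          ((x p, p), (dirDeriv x p η, η)) ((b, 0), 0) = M b := rfl
      simp only [dirDeriv_prodTangent (hF p hp), hM]
      simp [J₁, hJ]

/-- **Implicit function theorem** for maps to a Banach space with parameters in a locally convex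
space. -/
theorem exists_implicit [CompleteSpace B] {F : B × P → B} {x₀ : B} {p₀ : P}
    (hF : SmoothAt F (x₀, p₀)) (h0 : F (x₀, p₀) = 0)
    (hd : ∀ b, dirDeriv F (x₀, p₀) (b, 0) = b) :
    ∃ ξ : P → B, ξ p₀ = x₀ ∧ SmoothAt ξ p₀ ∧ ∀ᶠ q in 𝓝 (x₀, p₀), (F q = 0 ↔ q.1 = ξ q.2) := by
  have hhalf : (0 : ℝ) < 1 / 2 := by norm_num
  have h1 := hF.eventually_strict hhalf
  have h2 := (hF.eventually_norm_dirDeriv_sub_le hhalf).and hF.eventually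
  rw [nhds_prod_eq, nhds_prod_eq] at h1
  rw [nhds_prod_eq] at h2
  obtain ⟨pa, hpa, pb, hpb, hab⟩ := eventually_prod_iff.1 h1
  obtain ⟨pa', hpa', pb', hpb', hab'⟩ := eventually_prod_iff.1 h2
  obtain ⟨pc, hpc, pd, hpd, hcd⟩ := eventually_prod_iff.1 hpa
  obtain ⟨r, hr, hball⟩ := Metric.nhds_basis_closedBall.eventually_iff.1 ((hpc.and hpd).and hpa')
  have hF0 : ∀ᶠ p in 𝓝 p₀, ‖F (x₀, p)‖ < r / 2 := by
    have hc : ContinuousAt (fun p => F (x₀, p)) p₀ := hF.partial_right.continuousAt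
    refine hc.norm.eventually_lt continuousAt_const ?_
    simp only [h0, norm_zero]
    positivity
  obtain ⟨W, hWs, hW, hpW⟩ := mem_nhds_iff.1 ((hpb.and hpb').and hF0)
  have hctr : ∀ p ∈ W, ∀ x ∈ Metric.closedBall x₀ r, ∀ x' ∈ Metric.closedBall x₀ r,
      ‖F (x, p) - F (x', p) - (x - x')‖ ≤ 1 / 2 * ‖x - x'‖ := fun p hp x hx x' hx' => by
    have := hab (hcd (hball hx).1.1 (hball hx').1.2) (hWs hp).1.1
    simpa only [hd] using this
  have hbd : ∀ p ∈ W, ∀ x ∈ Metric.closedBall x₀ r, ∀ x' ∈ Metric.closedBall x₀ r,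
      ‖x - x'‖ ≤ 2 * ‖F (x, p) - F (x', p)‖ := fun p hp x hx x' hx' => by
    have h4 := hctr p hp x hx x' hx'
    have h5 := norm_le_norm_add_norm_sub (F (x, p) - F (x', p)) (x - x')
    linarith
  -- the solution is the fixed point of the contraction `x ↦ x - F (x, p)` of the ball
  have hex : ∀ p, ∃ x, p ∈ W → x ∈ Metric.closedBall x₀ r ∧ F (x, p) = 0 := fun p => by
    by_cases hp : p ∈ W
    swap
    · exact ⟨x₀, fun h => absurd h hp⟩
    have hmaps : MapsTo (fun x => x - F (x, p)) (Metric.closedBall x₀ r)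
        (Metric.closedBall x₀ r) := fun x hx => by
      have h4 := hctr p hp x hx x₀ (Metric.mem_closedBall_self hr.le)
      have h5 := (hWs hp).2
      rw [Metric.mem_closedBall, dist_eq_norm] at hx ⊢
      have e : x - F (x, p) - x₀ = -(F (x, p) - F (x₀, p) - (x - x₀)) - F (x₀, p) := by abel
      rw [e]
      refine (norm_sub_le _ _).trans ?_
      rw [norm_neg]
      have h5 : ‖F (x₀, p)‖ < r / 2 := h5
      linarith
    have hcon : ContractingWith (1 / 2 : NNReal) (hmaps.restrict _ _ _) := by
      refine ⟨by rw [← NNReal.coe_lt_coe]; norm_num, LipschitzWith.of_dist_le_mul fun x y => ?_⟩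
      have h4 := hctr p hp x x.2 y y.2
      rw [Subtype.dist_eq, Subtype.dist_eq, dist_eq_norm, dist_eq_norm]
      simp only [MapsTo.val_restrict_apply]
      have e : (x : B) - F (x, p) - (y - F (y, p)) = -(F (x, p) - F (y, p) - (x - y)) := by abel
      rw [e, norm_neg]
      simpa using h4
    obtain ⟨y, hy, hfix, -⟩ := hcon.exists_fixedPoint' Metric.isClosed_closedBall.isComplete hmaps
      (Metric.mem_closedBall_self hr.le) (edist_ne_top _ _)
    exact ⟨y, fun _ => ⟨hy, by simpa [Function.IsFixedPt] using hfix⟩⟩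
  choose ξ hξ using hex
  have huniq : ∀ p ∈ W, ∀ x ∈ Metric.closedBall x₀ r, F (x, p) = 0 → x = ξ p :=
    fun p hp x hx h => by
      have := hbd p hp x hx (ξ p) (hξ p hp).1
      rw [h, (hξ p hp).2, sub_zero, norm_zero, mul_zero] at this
      exact sub_eq_zero.1 (norm_le_zero_iff.1 this)
  have hsm : ∀ p ∈ W, SmoothAt F (ξ p, p) := fun p hp =>
    (hab' (hball (hξ p hp).1).2 (hWs hp).1.2).2
  have hcont : ContinuousOn ξ W := fun p hp => by
    refine ContinuousAt.continuousWithinAt (tendsto_iff_norm_sub_tendsto_zero.2 ?_)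
    have hc := ((hsm p hp).partial_right.continuousAt.norm.tendsto).const_mul 2
    rw [(hξ p hp).2, norm_zero, mul_zero] at hc
    refine squeeze_zero' (Eventually.of_forall fun _ => norm_nonneg _) ?_ hc
    filter_upwards [hW.mem_nhds hp] with q hq
    have := hbd q hq (ξ q) (hξ q hq).1 (ξ p) (hξ p hp).1
    rwa [(hξ q hq).2, zero_sub, norm_neg] at this
  refine ⟨ξ, (huniq p₀ hpW x₀ (Metric.mem_closedBall_self hr.le) h0).symm, ?_, ?_⟩
  · refine ⟨W, hW, hpW, fun n => isCr_implicit n hW hcont hsm (fun p hp => (hξ p hp).2)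
      fun p hp => ?_⟩
    let A : B →L[ℝ] B := (hsm p hp).deriv.comp (ContinuousLinearMap.inl ℝ B P)
    have hA : ‖1 - A‖ ≤ 1 / 2 := ContinuousLinearMap.opNorm_le_bound _ hhalf.le fun b => by
      have := (hab' (hball (hξ p hp).1).2 (hWs hp).1.2).1 b
      rw [hd, norm_sub_rev] at this
      exact this
    have hAu : IsUnit A := by
      have := isUnit_one_sub_of_norm_lt_one (lt_of_le_of_lt hA (by norm_num))
      rwa [sub_sub_cancel] at this
    obtain ⟨u, hu⟩ := hAu
    refine ⟨(u⁻¹ : (B →L[ℝ] B)ˣ), fun b => ?_⟩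
    have h4 := DFunLike.congr_fun (u.inv_mul) b
    rw [hu] at h4
    exact h4
  · rw [nhds_prod_eq]
    refine eventually_prod_iff.2 ⟨_, Metric.closedBall_mem_nhds x₀ hr, _, hW.mem_nhds hpW,
      fun {x} hx {p} hp => ⟨fun h => huniq p hp x hx h, fun h => ?_⟩⟩
    simp only at h
    rw [h]
    exact (hξ p hp).2

end Implicit

/-! ### Smooth maps from vector spaces to manifolds -/

section MSmooth

variable {X : Type*} [AddCommGroup X] [Module ℝ X] [TopologicalSpace X]
  [IsTopologicalAddGroup X] [ContinuousSMul ℝ X] [LocallyConvexSpace ℝ X] [T2Space X]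
  {E : Type*} [AddCommGroup E] [Module ℝ E] [TopologicalSpace E]
  [IsTopologicalAddGroup E] [ContinuousSMul ℝ E] [LocallyConvexSpace ℝ E] [T2Space E]
  {F : Type*} [AddCommGroup F] [Module ℝ F] [TopologicalSpace F]
  [IsTopologicalAddGroup F] [ContinuousSMul ℝ F] [LocallyConvexSpace ℝ F] [T2Space F]
  {M : Type*} [TopologicalSpace M] [ChartedSpace E M]
  {N : Type*} [TopologicalSpace N] [ChartedSpace F N]

variable (E) in
/-- The map `f` from a vector space to a manifold modelled on `E` is smooth near `x`, that is, it is
continuous at `x` and smooth near `x` in each chart of the atlas around `f x`. -/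
def MSmoothAt (f : X → M) (x : X) : Prop :=
  ContinuousAt f x ∧ ∀ e ∈ atlas E M, f x ∈ e.source → SmoothAt (fun y => e (f y)) x

theorem SmoothChange.smoothAt {e e' : OpenPartialHomeomorph M E} (h : SmoothChange e e') {z : E}
    (hz : z ∈ e.target) (hz' : e.symm z ∈ e'.source) : SmoothAt (fun z => e' (e.symm z)) z :=
  SmoothOn.smoothAt h (e.symm.trans e').open_source (by simp [hz, hz'])

theorem MSmoothAt.of_chart (hM : IsManifold E M) {f : X → M} {x : X} (hf : ContinuousAt f x)
    {e : OpenPartialHomeomorph M E} (he : e ∈ atlas E M) (hx : f x ∈ e.source)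
    (hs : SmoothAt (fun y => e (f y)) x) : MSmoothAt E f x := by
  refine ⟨hf, fun e' he' hx' => ?_⟩
  have h1 : SmoothAt (fun z => e' (e.symm z)) (e (f x)) :=
    (hM.smooth_change e he e' he').smoothAt (e.map_source hx) (by rwa [e.left_inv hx])
  refine (SmoothAt.comp (f := fun y => e (f y)) h1 hs).congr ?_
  filter_upwards [hf (e.open_source.mem_nhds hx)] with y hy
  rw [e.left_inv hy]

theorem MSmoothAt.chart_symm (hM : IsManifold E M) {e : OpenPartialHomeomorph M E}
    (he : e ∈ atlas E M) {u : X → E} {x : X} (hu : SmoothAt u x) (hx : u x ∈ e.target) :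
    MSmoothAt E (fun y => e.symm (u y)) x := by
  refine MSmoothAt.of_chart hM (ContinuousAt.comp (f := u) (e.continuousAt_symm hx)
    hu.continuousAt) he (e.map_target hx) (hu.congr ?_)
  filter_upwards [hu.continuousAt (e.open_target.mem_nhds hx)] with y hy
  exact (e.right_inv hy).symm

theorem SmoothMap.comp_mSmoothAt {f : M → N} (hf : SmoothMap E F f) {g : X → M} {x : X}
    (hg : MSmoothAt E g x) : MSmoothAt F (fun y => f (g y)) x := by
  refine ⟨ContinuousAt.comp (f := g) hf.1.continuousAt hg.1, fun e' he' hx' => ?_⟩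
  set e := chartAt E (g x)
  have hx : g x ∈ e.source := mem_chart_source E (g x)
  have ho : IsOpen (e.target ∩ {z | f (e.symm z) ∈ e'.source}) :=
    (hf.1.comp_continuousOn e.continuousOn_symm).isOpen_inter_preimage e.open_target e'.open_source
  have h1 : SmoothAt (fun z => e' (f (e.symm z))) (e (g x)) :=
    SmoothOn.smoothAt (hf.2 e (chart_mem_atlas E _) e' he') ho
      ⟨e.map_source hx, by simpa [e.left_inv hx] using hx'⟩
  refine (SmoothAt.comp (f := fun y => e (g y)) h1 (hg.2 e (chart_mem_atlas E _) hx)).congr ?_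
  filter_upwards [hg.1 (e.open_source.mem_nhds hx)] with y hy
  rw [e.left_inv hy]

theorem MSmoothAt.prodMk {f : X → M} {g : X → N} {x : X} (hf : MSmoothAt E f x)
    (hg : MSmoothAt F g x) : MSmoothAt (E × F) (fun y => (f y, g y)) x := by
  refine ⟨hf.1.prodMk hg.1, ?_⟩
  rintro _ ⟨e, he, e', he', rfl⟩ ⟨hx, hx'⟩
  exact (hf.2 e he hx).prodMk (hg.2 e' he' hx')

theorem mSmoothAt_self_iff {f : X → E} {x : X} : MSmoothAt E f x ↔ SmoothAt f x := by
  constructor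
  · intro h
    simpa using h.2 (OpenPartialHomeomorph.refl E) (by simp) (by simp)
  · intro h
    refine ⟨h.continuousAt, fun e he _ => ?_⟩
    rw [chartedSpaceSelf_atlas] at he
    subst he
    simpa using h

theorem MSmoothAt.congr {f g : X → M} {x : X} (hf : MSmoothAt E f x) (h : f =ᶠ[𝓝 x] g) :
    MSmoothAt E g x := by
  refine ⟨hf.1.congr h, fun e he hx => ?_⟩
  refine (hf.2 e he (by rwa [h.self_of_nhds])).congr ?_
  filter_upwards [h] with y hy
  rw [hy]

theorem MSmoothAt.comp {Y : Type*} [AddCommGroup Y] [Module ℝ Y] [TopologicalSpace Y]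
    [IsTopologicalAddGroup Y] [ContinuousSMul ℝ Y] [LocallyConvexSpace ℝ Y] [T2Space Y]
    {f : X → M} {g : Y → X} {y : Y} (hf : MSmoothAt E f (g y)) (hg : SmoothAt g y) :
    MSmoothAt E (fun z => f (g z)) y :=
  ⟨ContinuousAt.comp (f := g) hf.1 hg.continuousAt,
    fun e he hx => SmoothAt.comp (f := g) (hf.2 e he hx) hg⟩

theorem mSmoothAt_const (m : M) (x : X) : MSmoothAt E (fun _ => m) x :=
  ⟨continuousAt_const, fun e _ _ => smoothAt_const (e m) x⟩

/-- Smoothness of a map between manifolds, in terms of compositions with inverse charts. -/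
theorem SmoothMap.of_mSmoothAt {f : M → N} (hc : Continuous f)
    (h : ∀ e ∈ atlas E M, ∀ z ∈ e.target, MSmoothAt F (fun z => f (e.symm z)) z) :
    SmoothMap E F f :=
  ⟨hc, fun e he e' he' => smoothOn_of_smoothAt fun z hz => (h e he z hz.1).2 e' he' hz.2⟩

end MSmooth

/-! ### The adjoint action -/

section Adjoint

variable {X : Type*} [AddCommGroup X] [Module ℝ X] [TopologicalSpace X]
  [IsTopologicalAddGroup X] [ContinuousSMul ℝ X] [LocallyConvexSpace ℝ X] [T2Space X]
  {E : Type*} [AddCommGroup E] [Module ℝ E] [TopologicalSpace E]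
  [IsTopologicalAddGroup E] [ContinuousSMul ℝ E] [LocallyConvexSpace ℝ E] [T2Space E]
  {G : Type*} [Group G] [TopologicalSpace G] [ChartedSpace E G]

theorem IsLieGroup.isTopologicalGroup (hG : IsLieGroup E G) : IsTopologicalGroup G where
  continuous_mul := hG.smooth_mul.1
  continuous_inv := hG.smooth_inv.1

theorem MSmoothAt.mul (hG : IsLieGroup E G) {f g : X → G} {x : X} (hf : MSmoothAt E f x)
    (hg : MSmoothAt E g x) : MSmoothAt E (fun y => f y * g y) x :=
  hG.smooth_mul.comp_mSmoothAt (g := fun y => (f y, g y)) (hf.prodMk hg)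

theorem MSmoothAt.inv (hG : IsLieGroup E G) {f : X → G} {x : X} (hf : MSmoothAt E f x) :
    MSmoothAt E (fun y => (f y)⁻¹) x :=
  hG.smooth_inv.comp_mSmoothAt hf

variable (E G) in
/-- The preferred chart around the unit element. -/
abbrev oneChart : OpenPartialHomeomorph G E := chartAt E (1 : G)

variable (E G) in
/-- The position of the unit element in the preferred chart around it. -/
abbrev oneCoord : E := oneChart E G 1

theorem one_mem_source : (1 : G) ∈ (oneChart E G).source := mem_chart_source E 1

theorem oneCoord_mem_target : oneCoord E G ∈ (oneChart E G).target :=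
  (oneChart E G).map_source one_mem_source

theorem oneChart_symm_oneCoord : (oneChart E G).symm (oneCoord E G) = 1 :=
  (oneChart E G).left_inv one_mem_source

theorem mSmoothAt_oneChart_symm (hG : IsLieGroup E G) {u : X → E} {x : X} (hu : SmoothAt u x)
    (hx : u x ∈ (oneChart E G).target) : MSmoothAt E (fun y => (oneChart E G).symm (u y)) x :=
  MSmoothAt.chart_symm hG.toIsManifold (chart_mem_atlas E _) hu hx

theorem mSmoothAt_oneChart_symm_self (hG : IsLieGroup E G) :
    MSmoothAt E (fun y => (oneChart E G).symm y) (oneCoord E G) :=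
  mSmoothAt_oneChart_symm hG (smoothAt_id _) oneCoord_mem_target

theorem MSmoothAt.oneChart {f : X → G} {x : X} (hf : MSmoothAt E f x)
    (hx : f x ∈ (oneChart E G).source) : SmoothAt (fun y => oneChart E G (f y)) x :=
  hf.2 _ (chart_mem_atlas E _) hx

theorem MSmoothAt.oneChart_of_eq {f : X → G} {x : X} (hf : MSmoothAt E f x)
    (hx : f x = 1) : SmoothAt (fun y => LCLie.oneChart E G (f y)) x :=
  hf.oneChart (hx ▸ one_mem_source)

theorem MSmoothAt.eventually_mem_source {f : X → G} {x : X} (hf : MSmoothAt E f x)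
    (hx : f x = 1) : ∀ᶠ y in 𝓝 x, f y ∈ (LCLie.oneChart E G).source :=
  hf.1 ((LCLie.oneChart E G).open_source.mem_nhds (hx ▸ one_mem_source))

theorem eventually_right_inv_oneChart :
    ∀ᶠ z in 𝓝 (oneCoord E G), oneChart E G ((oneChart E G).symm z) = z := by
  filter_upwards [(oneChart E G).open_target.mem_nhds oneCoord_mem_target] with z hz
  exact (oneChart E G).right_inv hz

/-- If `u` is smooth near `1` as a function of `oneChart`, the derivative of `u ∘ f` is obtained from
that of `f` in the chart. -/
theorem dirDeriv_comp_of_eq_one {K : Type*} [AddCommGroup K] [Module ℝ K] [TopologicalSpace K]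
    [IsTopologicalAddGroup K] [ContinuousSMul ℝ K] [LocallyConvexSpace ℝ K] [T2Space K]
    {u : G → K} (hu : SmoothAt (fun z => u ((oneChart E G).symm z)) (oneCoord E G))
    {f : X → G} {x : X} (hf : MSmoothAt E f x) (hx : f x = 1) (v : X) :
    dirDeriv (fun y => u (f y)) x v =
      dirDeriv (fun z => u ((oneChart E G).symm z)) (oneCoord E G)
        (dirDeriv (fun y => oneChart E G (f y)) x v) := by
  have h1 : (fun y => u (f y)) =ᶠ[𝓝 x]
      fun y => u ((oneChart E G).symm (oneChart E G (f y))) := by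
    filter_upwards [hf.eventually_mem_source hx] with y hy
    rw [(oneChart E G).left_inv hy]
  rw [dirDeriv_congr h1]
  have hu' : SmoothAt (fun z => u ((oneChart E G).symm z)) (oneChart E G (f x)) := by rwa [hx]
  rw [SmoothAt.dirDeriv_comp (f := fun y => oneChart E G (f y)) hu' (hf.oneChart_of_eq hx), hx]

/-- The local multiplication is smooth near the unit element. -/
theorem smoothAt_localMul (hG : IsLieGroup E G) : SmoothAt (fun z : E × E =>
    oneChart E G ((oneChart E G).symm z.1 * (oneChart E G).symm z.2))
      (oneCoord E G, oneCoord E G) := by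
  refine MSmoothAt.oneChart_of_eq (MSmoothAt.mul hG ?_ ?_) ?_
  · exact mSmoothAt_oneChart_symm hG (smoothAt_fst _) oneCoord_mem_target
  · exact mSmoothAt_oneChart_symm hG (smoothAt_snd _) oneCoord_mem_target
  · simp

/-- At the unit element, the derivative of a product is the sum of the derivatives. -/
theorem dirDeriv_mul (hG : IsLieGroup E G) {f g : X → G} {x : X} (hf : MSmoothAt E f x)
    (hg : MSmoothAt E g x) (hfx : f x = 1) (hgx : g x = 1) (v : X) :
    dirDeriv (fun y => oneChart E G (f y * g y)) x v =
      dirDeriv (fun y => oneChart E G (f y)) x v + dirDeriv (fun y => oneChart E G (g y)) x v := by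
  have h1 : (fun y => oneChart E G (f y * g y)) =ᶠ[𝓝 x] fun y => oneChart E G
      ((oneChart E G).symm (oneChart E G (f y)) * (oneChart E G).symm (oneChart E G (g y))) := by
    filter_upwards [hf.eventually_mem_source hfx, hg.eventually_mem_source hgx] with y h1 h2
    rw [(oneChart E G).left_inv h1, (oneChart E G).left_inv h2]
  have hμ := smoothAt_localMul hG
  have hμ' : SmoothAt (fun z : E × E =>
      oneChart E G ((oneChart E G).symm z.1 * (oneChart E G).symm z.2))
      (oneChart E G (f x), oneChart E G (g x)) := by rwa [hfx, hgx]
  rw [dirDeriv_congr h1, SmoothAt.dirDeriv_comp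
    (f := fun y => (oneChart E G (f y), oneChart E G (g y))) hμ'
    ((hf.oneChart_of_eq hfx).prodMk (hg.oneChart_of_eq hgx)),
    (hf.oneChart_of_eq hfx).dirDeriv_prodMk (hg.oneChart_of_eq hgx), hfx, hgx,
    hμ.dirDeriv_split]
  have e : ∀ᶠ z in 𝓝 (oneCoord E G), oneChart E G ((oneChart E G).symm z) = z :=
    eventually_right_inv_oneChart
  simp only [oneChart_symm_oneCoord, mul_one, one_mul]
  rw [dirDeriv_congr e, dirDeriv_id, dirDeriv_congr e, dirDeriv_id]

/-- The adjoint action of `g` on the tangent space at `1`, computed in the preferred chart. -/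
noncomputable def Ad (g : G) (w : E) : E :=
  dirDeriv (fun z => oneChart E G (g * (oneChart E G).symm z * g⁻¹)) (oneCoord E G) w

theorem smoothAt_conj (hG : IsLieGroup E G) (g : G) :
    SmoothAt (fun z => oneChart E G (g * (oneChart E G).symm z * g⁻¹)) (oneCoord E G) :=
  MSmoothAt.oneChart_of_eq (((mSmoothAt_const g _).mul hG (mSmoothAt_oneChart_symm_self hG)).mul hG
    (mSmoothAt_const g⁻¹ _)) (by simp)

theorem dirDeriv_conj (hG : IsLieGroup E G) (g : G) {f : X → G} {x : X} (hf : MSmoothAt E f x)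
    (hx : f x = 1) (v : X) : dirDeriv (fun y => oneChart E G (g * f y * g⁻¹)) x v =
      Ad g (dirDeriv (fun y => oneChart E G (f y)) x v) :=
  dirDeriv_comp_of_eq_one (u := fun k => oneChart E G (g * k * g⁻¹)) (smoothAt_conj hG g) hf hx v

theorem Ad_add (hG : IsLieGroup E G) (g : G) (v w : E) : Ad g (v + w) = Ad g v + Ad g w :=
  (smoothAt_conj hG g).dirDeriv_add_dir v w

theorem Ad_smul (hG : IsLieGroup E G) (g : G) (c : ℝ) (w : E) : Ad g (c • w) = c • Ad g w :=
  (smoothAt_conj hG g).dirDeriv_smul_dir c w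

theorem Ad_one (w : E) : Ad (1 : G) w = w := by
  unfold Ad
  have e : (fun z => oneChart E G (1 * (oneChart E G).symm z * 1⁻¹)) =ᶠ[𝓝 (oneCoord E G)]
      fun z => z := by
    filter_upwards [eventually_right_inv_oneChart (E := E) (G := G)] with z hz
    simpa using hz
  rw [dirDeriv_congr e, dirDeriv_id]

theorem Ad_mul (hG : IsLieGroup E G) (g k : G) (w : E) : Ad (g * k) w = Ad g (Ad k w) := by
  have := dirDeriv_conj hG g (f := fun z => k * (oneChart E G).symm z * k⁻¹) (x := oneCoord E G)
    (((mSmoothAt_const k _).mul hG (mSmoothAt_oneChart_symm_self hG)).mul hG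
    (mSmoothAt_const k⁻¹ _)) (by simp) w
  refine Eq.trans ?_ this
  simp only [Ad, mul_inv_rev, mul_assoc]

theorem SmoothAt.Ad (hG : IsLieGroup E G) {f : X → G} {u : X → E} {x : X} (hf : MSmoothAt E f x)
    (hu : SmoothAt u x) : SmoothAt (fun y => Ad (f y) (u y)) x := by
  have hΓ : SmoothAt (fun q : X × E => oneChart E G (f q.1 * (oneChart E G).symm q.2 * (f q.1)⁻¹))
      (x, oneCoord E G) := by
    have hf' : MSmoothAt E (fun q : X × E => f q.1) (x, oneCoord E G) :=
      MSmoothAt.comp (g := fun q : X × E => q.1) hf (smoothAt_fst _)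
    exact MSmoothAt.oneChart_of_eq ((hf'.mul hG (mSmoothAt_oneChart_symm hG (smoothAt_snd _)
      oneCoord_mem_target)).mul hG (hf'.inv hG)) (by simp)
  refine (SmoothAt.dirDeriv_apply (a := fun y => (y, oneCoord E G)) (b := fun y => ((0 : X), u y))
    hΓ ((smoothAt_id x).prodMk (smoothAt_const _ _)) ((smoothAt_const _ _).prodMk hu)).congr ?_
  have hc : Tendsto (fun y : X => (y, oneCoord E G)) (𝓝 x) (𝓝 (x, oneCoord E G)) :=
    tendsto_id.prodMk_nhds tendsto_const_nhds
  filter_upwards [hc.eventually hΓ.eventually] with y hy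
  exact hy.dirDeriv_right (u y)

end Adjoint

/-! ### The Lie bracket as the derivative of the adjoint action -/

section Bracket

variable {E : Type*} [AddCommGroup E] [Module ℝ E] [TopologicalSpace E]
  [IsTopologicalAddGroup E] [ContinuousSMul ℝ E] [LocallyConvexSpace ℝ E] [T2Space E]
  {G : Type*} [Group G] [TopologicalSpace G] [ChartedSpace E G]

variable (E G) in
/-- Multiplication in the preferred chart around the unit element. -/
noncomputable def localMul (z : E × E) : E :=
  oneChart E G ((oneChart E G).symm z.1 * (oneChart E G).symm z.2)

theorem smoothAt_localMul_left (hG : IsLieGroup E G) {y : E} (hy : y ∈ (oneChart E G).target) :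
    SmoothAt (localMul E G) (y, oneCoord E G) :=
  MSmoothAt.oneChart (MSmoothAt.mul hG (mSmoothAt_oneChart_symm hG (smoothAt_fst _) hy)
    (mSmoothAt_oneChart_symm hG (smoothAt_snd _) oneCoord_mem_target))
    (by simpa using (oneChart E G).map_target hy)

theorem smoothAt_localMul_right (hG : IsLieGroup E G) {y : E} (hy : y ∈ (oneChart E G).target) :
    SmoothAt (localMul E G) (oneCoord E G, y) :=
  MSmoothAt.oneChart (MSmoothAt.mul hG
    (mSmoothAt_oneChart_symm hG (smoothAt_fst _) oneCoord_mem_target)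
    (mSmoothAt_oneChart_symm hG (smoothAt_snd _) hy))
    (by simpa using (oneChart E G).map_target hy)

/-- The local representative of a left invariant vector field. -/
theorem localRep_leftInv (hG : IsLieGroup E G) (w : E) {y : E} (hy : y ∈ (oneChart E G).target) :
    localRep E (leftInv E w : ∀ x : G, TangentAt E x) (oneChart E G) y =
      dirDeriv (localMul E G) (y, oneCoord E G) (0, w) := by
  set g := (oneChart E G).symm y with hg
  have hgs : g ∈ (oneChart E G).source := (oneChart E G).map_target hy
  rw [(smoothAt_localMul_left hG hy).dirDeriv_right]
  unfold localRep leftInv tangentMap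
  rw [← hg]
  simp only [mul_one, chartAt_self_eq, OpenPartialHomeomorph.refl_apply]
  have h1 : SmoothAt (fun z => oneChart E G ((chartAt E g).symm z)) (chartAt E g g) :=
    (hG.smooth_change _ (chart_mem_atlas E g) _ (chart_mem_atlas E 1)).smoothAt
      (mem_chart_target E g) (by simpa using hgs)
  have h2 : MSmoothAt E (fun z => g * (oneChart E G).symm z) (oneCoord E G) :=
    (mSmoothAt_const g _).mul hG (mSmoothAt_oneChart_symm_self hG)
  have h3 : SmoothAt (fun z => chartAt E g (g * (oneChart E G).symm z)) (oneCoord E G) :=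
    h2.2 _ (chart_mem_atlas E g) (by simp)
  have h4 : g * (oneChart E G).symm (oneCoord E G) = g := by simp
  have h1' : SmoothAt (fun z => oneChart E G ((chartAt E g).symm z))
      (chartAt E g (g * (oneChart E G).symm (oneCoord E G))) := by rwa [h4]
  have h5 := SmoothAt.dirDeriv_comp (f := fun z => chartAt E g (g * (oneChart E G).symm z)) h1' h3 w
  rw [h4] at h5
  refine h5.symm.trans (dirDeriv_congr ?_ w)
  have h6 : g * (oneChart E G).symm (oneCoord E G) ∈ (chartAt E g).source := by simp
  filter_upwards [h2.1 ((chartAt E g).open_source.mem_nhds h6)] with z hz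
  rw [(chartAt E g).left_inv hz]
  rfl

theorem dirDeriv_localMul_oneCoord_right (hG : IsLieGroup E G) (w : E) :
    dirDeriv (localMul E G) (oneCoord E G, oneCoord E G) (0, w) = w := by
  rw [(smoothAt_localMul_left hG oneCoord_mem_target).dirDeriv_right]
  have e : (fun z => localMul E G (oneCoord E G, z)) =ᶠ[𝓝 (oneCoord E G)] fun z => z := by
    filter_upwards [eventually_right_inv_oneChart (E := E) (G := G)] with z hz
    simpa [localMul] using hz
  rw [dirDeriv_congr e, dirDeriv_id]

theorem dirDeriv_localMul_oneCoord_left (hG : IsLieGroup E G) (w : E) :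
    dirDeriv (localMul E G) (oneCoord E G, oneCoord E G) (w, 0) = w := by
  rw [(smoothAt_localMul_left hG oneCoord_mem_target).dirDeriv_left]
  have e : (fun z => localMul E G (z, oneCoord E G)) =ᶠ[𝓝 (oneCoord E G)] fun z => z := by
    filter_upwards [eventually_right_inv_oneChart (E := E) (G := G)] with z hz
    simpa [localMul] using hz
  rw [dirDeriv_congr e, dirDeriv_id]

theorem lieBracket_eq_localMul (hG : IsLieGroup E G) (v w : E) :
    lieBracket E (G := G) v w =
      dirDeriv (fun y => dirDeriv (localMul E G) (y, oneCoord E G) (0, w)) (oneCoord E G) v -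
      dirDeriv (fun y => dirDeriv (localMul E G) (y, oneCoord E G) (0, v)) (oneCoord E G) w := by
  have e : ∀ w : E, (localRep E (leftInv E w : ∀ x : G, TangentAt E x) (oneChart E G))
      =ᶠ[𝓝 (oneCoord E G)] fun y => dirDeriv (localMul E G) (y, oneCoord E G) (0, w) := fun w => by
    filter_upwards [(oneChart E G).open_target.mem_nhds oneCoord_mem_target] with y hy
    exact localRep_leftInv hG w hy
  have e0 : ∀ w : E, localRep E (leftInv E w : ∀ x : G, TangentAt E x) (oneChart E G)
      (oneCoord E G) = w := fun w => by
    rw [localRep_leftInv hG w oneCoord_mem_target, dirDeriv_localMul_oneCoord_right hG]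
  unfold lieBracket vfBracket
  rw [dirDeriv_congr (e v), dirDeriv_congr (e w), e0, e0]

/-- The bracket `[v, w]` is the derivative of `g ↦ Ad g w` at `1` in direction `v`: differentiating
`g k = (g k g⁻¹) g` in `k` and then in `g` gives this up to the order of differentiation, which
Schwarz's theorem allows to interchange. -/
theorem lieBracket_eq_dirDeriv_Ad (hG : IsLieGroup E G) (v w : E) :
    lieBracket E (G := G) v w =
      dirDeriv (fun z => Ad ((oneChart E G).symm z) w) (oneCoord E G) v := by
  set p₀ := oneCoord E G with hp₀
  have hμ : SmoothAt (localMul E G) (p₀, p₀) := smoothAt_localMul hG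
  have hA : SmoothAt (fun z => Ad ((oneChart E G).symm z) w) p₀ :=
    SmoothAt.Ad hG (mSmoothAt_oneChart_symm_self hG) (smoothAt_const w _)
  have hA0 : Ad ((oneChart E G).symm p₀) w = w := by
    rw [hp₀, oneChart_symm_oneCoord, Ad_one]
  have key : (fun y => dirDeriv (localMul E G) (y, p₀) (0, w)) =ᶠ[𝓝 p₀]
      fun y => dirDeriv (localMul E G) (p₀, y) (Ad ((oneChart E G).symm y) w, 0) := by
    filter_upwards [(oneChart E G).open_target.mem_nhds oneCoord_mem_target] with y hy
    have hconj : MSmoothAt E (fun z => (oneChart E G).symm y * (oneChart E G).symm z *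
        ((oneChart E G).symm y)⁻¹) p₀ :=
      ((mSmoothAt_const _ _).mul hG (mSmoothAt_oneChart_symm_self hG)).mul hG (mSmoothAt_const _ _)
    have hconj1 : (oneChart E G).symm y * (oneChart E G).symm p₀ * ((oneChart E G).symm y)⁻¹ = 1 := by
      simp [hp₀]
    have hR := (smoothAt_localMul_right hG hy).partial_left
    have h1 := dirDeriv_comp_of_eq_one (E := E)
      (u := fun k : G => oneChart E G (k * (oneChart E G).symm y)) hR hconj hconj1 w
    rw [(smoothAt_localMul_left hG hy).dirDeriv_right, (smoothAt_localMul_right hG hy).dirDeriv_left]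
    refine Eq.trans ?_ h1
    simp only [inv_mul_cancel_right]
    rfl
  have h2 : SmoothAt (fun q : E × E => dirDeriv (localMul E G) (p₀, q.1) (q.2, 0)) (p₀, w) :=
    SmoothAt.dirDeriv_apply (a := fun q : E × E => (p₀, q.1)) (b := fun q : E × E => (q.2, (0 : E)))
      hμ ((smoothAt_const _ _).prodMk (smoothAt_fst _))
      ((smoothAt_snd _).prodMk (smoothAt_const _ _))
  have h2' : SmoothAt (fun q : E × E => dirDeriv (localMul E G) (p₀, q.1) (q.2, 0))
      (p₀, Ad ((oneChart E G).symm p₀) w) := by rwa [hA0]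
  have h3 := SmoothAt.dirDeriv_comp
    (f := fun y => (y, Ad ((oneChart E G).symm y) w)) h2' ((smoothAt_id p₀).prodMk hA) v
  rw [(smoothAt_id p₀).dirDeriv_prodMk hA, hA0, h2.dirDeriv_split, dirDeriv_id] at h3
  have h4 : (fun u => dirDeriv (localMul E G) (p₀, p₀) (u, 0)) = fun u => u := by
    funext u
    exact dirDeriv_localMul_oneCoord_left hG u
  simp only [h4, dirDeriv_id] at h3
  have hD : ∀ d : E × E, SmoothAt (fun q => dirDeriv (localMul E G) q d) (p₀, p₀) := fun d =>
    SmoothAt.dirDeriv_apply (a := fun q => q) hμ (smoothAt_id _) (smoothAt_const d _)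
  have h5 := hμ.dirDeriv_comm (w, 0) (0, v)
  rw [(hD _).dirDeriv_right, (hD _).dirDeriv_left] at h5
  rw [lieBracket_eq_localMul hG, dirDeriv_congr key, h3, h5, add_sub_cancel_left]

theorem lieBracket_add_right (hG : IsLieGroup E G) (v w w' : E) :
    (lieBracket E (G := G) v (w + w') : E) =
      lieBracket E (G := G) v w + lieBracket E (G := G) v w' := by
  have hA : ∀ w : E, SmoothAt (fun z => Ad ((oneChart E G).symm z) w) (oneCoord E G) := fun w =>
    SmoothAt.Ad hG (mSmoothAt_oneChart_symm_self hG) (smoothAt_const w _)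
  simp only [lieBracket_eq_dirDeriv_Ad hG, Ad_add hG]
  exact (((hA w).hasDirDeriv v).add ((hA w').hasDirDeriv v)).dirDeriv_eq

theorem lieBracket_smul_right (hG : IsLieGroup E G) (c : ℝ) (v w : E) :
    (lieBracket E (G := G) v (c • w) : E) = c • lieBracket E (G := G) v w := by
  have hA : ∀ w : E, SmoothAt (fun z => Ad ((oneChart E G).symm z) w) (oneCoord E G) := fun w =>
    SmoothAt.Ad hG (mSmoothAt_oneChart_symm_self hG) (smoothAt_const w _)
  simp only [lieBracket_eq_dirDeriv_Ad hG, Ad_smul hG]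
  exact (((hA w).hasDirDeriv v).const_smul c).dirDeriv_eq

theorem lieBracket_neg_left (hG : IsLieGroup E G) (v w : E) :
    (lieBracket E (G := G) (-v) w : E) = -lieBracket E (G := G) v w := by
  have hA : SmoothAt (fun z => Ad ((oneChart E G).symm z) w) (oneCoord E G) :=
    SmoothAt.Ad hG (mSmoothAt_oneChart_symm_self hG) (smoothAt_const w _)
  rw [lieBracket_eq_dirDeriv_Ad hG, lieBracket_eq_dirDeriv_Ad hG]
  simpa using hA.dirDeriv_smul_dir (-1) v

theorem continuous_lieBracket_right (hG : IsLieGroup E G) (v : E) :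
    Continuous fun w : E => (lieBracket E (G := G) v w : E) := by
  have h1 : ∀ w, SmoothAt (fun q : E × E => Ad ((oneChart E G).symm q.1) q.2) (oneCoord E G, w) :=
    fun w => SmoothAt.Ad hG (mSmoothAt_oneChart_symm hG (smoothAt_fst _) oneCoord_mem_target)
      (smoothAt_snd _)
  have h2 : (fun w : E => (lieBracket E (G := G) v w : E)) = fun w =>
      dirDeriv (fun q : E × E => Ad ((oneChart E G).symm q.1) q.2) (oneCoord E G, w) (v, 0) := by
    funext w
    rw [lieBracket_eq_dirDeriv_Ad hG, (h1 w).dirDeriv_left]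
  rw [h2]
  refine continuous_iff_continuousAt.2 fun w => SmoothAt.continuousAt
    (SmoothAt.dirDeriv_apply (a := fun w => (oneCoord E G, w)) (h1 w)
      ((smoothAt_const _ _).prodMk (smoothAt_id _)) (smoothAt_const _ _))

/-- The map `w ↦ [v, w]` as a continuous linear map. -/
noncomputable def adMap (hG : IsLieGroup E G) (v : E) : E →L[ℝ] E where
  toFun w := lieBracket E (G := G) v w
  map_add' := lieBracket_add_right hG v
  map_smul' c w := lieBracket_smul_right hG c v w
  cont := continuous_lieBracket_right hG v

end Bracket

/-! ### The exponential map and its logarithmic derivative -/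

section Exponential

variable {X : Type*} [AddCommGroup X] [Module ℝ X] [TopologicalSpace X]
  [IsTopologicalAddGroup X] [ContinuousSMul ℝ X] [LocallyConvexSpace ℝ X] [T2Space X]
  {E : Type*} [AddCommGroup E] [Module ℝ E] [TopologicalSpace E]
  [IsTopologicalAddGroup E] [ContinuousSMul ℝ E] [LocallyConvexSpace ℝ E] [T2Space E]
  {G : Type*} [Group G] [TopologicalSpace G] [ChartedSpace E G]
  {ex : E → G}

theorem IsExponentialMap.comp (hex : IsExponentialMap E ex) {u : X → E} {x : X}
    (hu : SmoothAt u x) : MSmoothAt E (fun y => ex (u y)) x :=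
  hex.smooth.comp_mSmoothAt (mSmoothAt_self_iff.2 hu)

theorem IsExponentialMap.zero (hex : IsExponentialMap E ex) : ex 0 = 1 := by
  have h : ex ((0 + 0 : ℝ) • (0 : E)) = ex ((0 : ℝ) • (0 : E)) * ex ((0 : ℝ) • (0 : E)) :=
    hex.add_smul (0 : E) 0 0
  simpa using h

theorem IsExponentialMap.add (hex : IsExponentialMap E ex) (v : E) (s t : ℝ) :
    ex ((s + t) • v) = ex (s • v) * ex (t • v) := hex.add_smul v s t

theorem IsExponentialMap.neg (hex : IsExponentialMap E ex) (v : E) : ex (-v) = (ex v)⁻¹ := by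
  have h := hex.add v (-1) 1
  rw [neg_add_cancel, zero_smul, hex.zero, one_smul, neg_smul, one_smul] at h
  exact eq_inv_of_mul_eq_one_left h.symm

theorem IsExponentialMap.dirDeriv_zero (hex : IsExponentialMap E ex) (v : E) :
    dirDeriv (fun y => oneChart E G (ex y)) 0 v = v := by
  have h := hex.hasDeriv v
  refine HasDirDeriv.dirDeriv_eq (hasDirDeriv_curve_iff.1 ?_)
  simpa using h

theorem IsExponentialMap.dirDeriv_comp (hex : IsExponentialMap E ex) {u : X → E} {x : X}
    (hu : SmoothAt u x) (hx : u x = 0) (v : X) :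
    dirDeriv (fun y => oneChart E G (ex (u y))) x v = dirDeriv u x v := by
  have h1 : SmoothAt (fun y => oneChart E G (ex y)) (u x) :=
    (hex.comp (smoothAt_id (u x))).oneChart_of_eq (by rw [hx, hex.zero])
  rw [SmoothAt.dirDeriv_comp (f := u) h1 hu, hx, hex.dirDeriv_zero]

/-- Derivative of `s ↦ Ad (exp (-s v)) (z s)`. -/
theorem IsExponentialMap.hasDirDeriv_Ad (hG : IsLieGroup E G) (hex : IsExponentialMap E ex) (v : E)
    {z : ℝ → E} {s : ℝ} {z' : E} (hz : HasDirDeriv z s 1 z') :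
    HasDirDeriv (fun s => Ad (ex (-(s • v))) (z s)) s 1
      (Ad (ex (-(s • v))) (z' - lieBracket E (G := G) v (z s))) := by
  have hlin : ∀ t : ℝ, SmoothAt (fun t : ℝ => -(t • v)) t := fun t =>
    (smoothAt_clm ((ContinuousLinearMap.id ℝ ℝ).smulRight v) t).neg
  have hA : ∀ (t : ℝ) (w : E), SmoothAt (fun q : ℝ × E => Ad (ex (-(q.1 • v))) q.2) (t, w) :=
    fun t w => SmoothAt.Ad hG (hex.comp (SmoothAt.comp (g := fun t : ℝ => -(t • v))
      (f := fun q : ℝ × E => q.1) (hlin t) (smoothAt_fst _))) (smoothAt_snd _)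
  have h1 := SmoothAt.hasDirDeriv_comp (f := fun t => (t, z t)) (hA s (z s))
    (((smoothAt_id s).hasDirDeriv 1).prodMk hz)
  rw [dirDeriv_id, (hA s (z s)).dirDeriv_split] at h1
  have h2 : dirDeriv (fun w => Ad (ex (-(s • v))) w) (z s) z' = Ad (ex (-(s • v))) z' :=
    dirDeriv_clm (smoothAt_conj hG (ex (-(s • v)))).deriv (z s) z'
  have h3 : HasDirDeriv (fun t : ℝ => Ad (ex (-(t • v))) (z s)) 0 1
      (-lieBracket E (G := G) v (z s)) := by
    have h4 : SmoothAt (fun t : ℝ => Ad (ex (-(t • v))) (z s)) 0 :=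
      SmoothAt.Ad hG (hex.comp (hlin 0)) (smoothAt_const _ _)
    have h5 := dirDeriv_comp_of_eq_one (E := E) (u := fun k : G => Ad k (z s))
      (SmoothAt.Ad hG (mSmoothAt_oneChart_symm_self hG) (smoothAt_const _ _))
      (hex.comp (hlin 0)) (by simp [hex.zero]) 1
    rw [← lieBracket_eq_dirDeriv_Ad hG, hex.dirDeriv_comp (hlin 0) (by simp)] at h5
    have h6 : dirDeriv (fun t : ℝ => -(t • v)) 0 1 = -v := by
      have := ((hasDirDeriv_clm ((ContinuousLinearMap.id ℝ ℝ).smulRight v) 0 1).neg).dirDeriv_eq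
      simpa using this
    rw [h6, lieBracket_neg_left hG] at h5
    rw [← h5]
    exact h4.hasDirDeriv 1
  have h7 : HasDirDeriv (fun t : ℝ => Ad (ex (-(t • v))) (z s)) s 1
      (Ad (ex (-(s • v))) (-lieBracket E (G := G) v (z s))) := by
    have := h3.clm_comp (smoothAt_conj hG (ex (-(s • v)))).deriv
    refine Tendsto.congr (fun t => ?_) this
    have e : ex (-((s + t) • v)) = ex (-(s • v)) * ex (-(t • v)) := by
      rw [← smul_neg, ← smul_neg, ← smul_neg, hex.add]
    simp only [SmoothAt.deriv_apply, smul_eq_mul, mul_one, zero_add, e, Ad_mul hG, zero_smul,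
      neg_zero, hex.zero, Ad_one]
    simp only [Ad]
  rw [h7.dirDeriv_eq, h2, ← Ad_add hG, neg_add_eq_sub] at h1
  exact h1

/-- The left logarithmic derivative of the exponential map at `v` in direction `w`. -/
noncomputable def expLogDeriv (ex : E → G) (v w : E) : E :=
  dirDeriv (fun y => oneChart E G (ex (-v) * ex y)) v w

theorem IsExponentialMap.smoothAt_neg_mul (hG : IsLieGroup E G) (hex : IsExponentialMap E ex)
    (v : E) : SmoothAt (fun q : E × E => oneChart E G (ex (-q.1) * ex q.2)) (v, v) :=
  MSmoothAt.oneChart_of_eq ((hex.comp (smoothAt_fst _).neg).mul hG (hex.comp (smoothAt_snd _)))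
    (by simp [hex.neg])

theorem IsExponentialMap.expLogDeriv_eq (hG : IsLieGroup E G) (hex : IsExponentialMap E ex)
    (v w : E) : expLogDeriv ex v w =
      dirDeriv (fun q : E × E => oneChart E G (ex (-q.1) * ex q.2)) (v, v) (0, w) :=
  ((hex.smoothAt_neg_mul hG v).dirDeriv_right w).symm

theorem IsExponentialMap.smoothAt_expLogDeriv (hG : IsLieGroup E G) (hex : IsExponentialMap E ex)
    {a b : X → E} {x : X} (ha : SmoothAt a x) (hb : SmoothAt b x) :
    SmoothAt (fun y => expLogDeriv ex (a y) (b y)) x := by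
  simp only [hex.expLogDeriv_eq hG]
  exact SmoothAt.dirDeriv_apply (a := fun y => (a y, a y)) (hex.smoothAt_neg_mul hG (a x))
    (ha.prodMk ha) ((smoothAt_const _ _).prodMk hb)

theorem IsExponentialMap.expLogDeriv_zero (hex : IsExponentialMap E ex) (w : E) :
    expLogDeriv ex 0 w = w := by
  simp [expLogDeriv, hex.zero, hex.dirDeriv_zero]

/-- The logarithmic derivative at `v` as a continuous linear map. -/
noncomputable def IsExponentialMap.logDerivCLM (hG : IsLieGroup E G) (hex : IsExponentialMap E ex)
    (v : E) : E →L[ℝ] E := (hex.smoothAt_neg_mul hG v).partial_right.deriv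

theorem IsExponentialMap.logDerivCLM_apply (hG : IsLieGroup E G) (hex : IsExponentialMap E ex)
    (v w : E) : hex.logDerivCLM hG v w = expLogDeriv ex v w := rfl

/-- The curve `s ↦ expLogDeriv (s v) (s w)` has derivative `Ad (exp (-s v)) w`. This follows from the
cocycle identity `N (s + t) = Ad (exp (-s v)) (N t) + N s`. -/
theorem IsExponentialMap.hasDirDeriv_expLogDeriv (hG : IsLieGroup E G)
    (hex : IsExponentialMap E ex) (v w : E) (s : ℝ) :
    HasDirDeriv (fun s : ℝ => expLogDeriv ex (s • v) (s • w)) s 1 (Ad (ex (-(s • v))) w) := by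
  have hN : ∀ s : ℝ, expLogDeriv ex (s • v) (s • w) =
      dirDeriv (fun y => oneChart E G (ex (-(s • v)) * ex (s • y))) v w := fun s => by
    have h1 := SmoothAt.dirDeriv_comp (f := fun y : E => s • y)
      (hex.smoothAt_neg_mul hG (s • v)).partial_right
      (smoothAt_clm (s • ContinuousLinearMap.id ℝ E) v) w
    have h2 : dirDeriv (fun y : E => s • y) v w = s • w :=
      dirDeriv_clm (s • ContinuousLinearMap.id ℝ E) v w
    rw [h2] at h1
    exact h1.symm
  have hsm : ∀ s : ℝ, MSmoothAt E (fun y => ex (-(s • v)) * ex (s • y)) v := fun s =>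
    (mSmoothAt_const _ _).mul hG (hex.comp (smoothAt_clm (s • ContinuousLinearMap.id ℝ E) v))
  have hadd : ∀ s t : ℝ, expLogDeriv ex ((s + t) • v) ((s + t) • w) =
      Ad (ex (-(s • v))) (expLogDeriv ex (t • v) (t • w)) + expLogDeriv ex (s • v) (s • w) :=
    fun s t => by
    have h1 : ∀ t : ℝ, ex (-(t • v)) * ex (t • v) = 1 := fun t => by simp [hex.neg]
    rw [hN, hN, hN, ← dirDeriv_conj hG _ (hsm t) (h1 t), ← dirDeriv_mul hG
      (((mSmoothAt_const _ _).mul hG (hsm t)).mul hG (mSmoothAt_const _ _)) (hsm s)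
      (by rw [h1]; group) (h1 s)]
    congr 1
    funext y
    have e1 : ex (-((s + t) • v)) = ex (-(s • v)) * ex (-(t • v)) := by
      rw [← smul_neg, ← smul_neg, ← smul_neg, hex.add]
    have e2 : ex ((s + t) • y) = ex (t • y) * ex (s • y) := by rw [add_comm, hex.add]
    rw [e1, e2]
    congr 1
    group
  have h0 : Tendsto (fun t : ℝ => expLogDeriv ex (t • v) w) (𝓝[≠] 0) (𝓝 w) := by
    have h1 : SmoothAt (fun t : ℝ => expLogDeriv ex (t • v) w) 0 :=
      hex.smoothAt_expLogDeriv hG (smoothAt_clm ((ContinuousLinearMap.id ℝ ℝ).smulRight v) 0)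
        (smoothAt_const _ _)
    have h2 := h1.continuousAt.tendsto
    rw [zero_smul, hex.expLogDeriv_zero] at h2
    exact h2.mono_left nhdsWithin_le_nhds
  have h3 := ((smoothAt_conj hG (ex (-(s • v)))).deriv.continuous.tendsto w).comp h0
  refine h3.congr' ?_
  filter_upwards [self_mem_nhdsWithin] with t ht
  have ht : t ≠ 0 := ht
  have e : expLogDeriv ex (t • v) (t • w) = t • expLogDeriv ex (t • v) w :=
    (hex.logDerivCLM hG (t • v)).map_smul t w
  simp only [smul_eq_mul, mul_one, hadd, add_sub_cancel_right, e, Ad_smul hG, smul_smul,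
    inv_mul_cancel₀ ht, one_smul]
  rfl

end Exponential

/-! ### Invariance of the subalgebra -/

section Invariance

variable {E : Type*} [AddCommGroup E] [Module ℝ E] [TopologicalSpace E]
  [IsTopologicalAddGroup E] [ContinuousSMul ℝ E] [LocallyConvexSpace ℝ E] [T2Space E]
  {G : Type*} [Group G] [TopologicalSpace G] [ChartedSpace E G]
  {ex : E → G}
  {B : Type*} [NormedAddCommGroup B] [NormedSpace ℝ B] [CompleteSpace B]
  {ι : B →L[ℝ] E} {pr : E →L[ℝ] B}

/-- If the image of the Banach space `B` is a subalgebra, then it is invariant under `Ad (exp v)` for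
its elements `v`: the curve `s ↦ Ad (exp (-s v)) (e^{s ad v} w)` is constant. -/
theorem IsExponentialMap.Ad_mem (hG : IsLieGroup E G) (hex : IsExponentialMap E ex)
    (hLie : ∀ b c : B, ι (pr (lieBracket E (G := G) (ι b) (ι c))) = lieBracket E (G := G) (ι b) (ι c))
    (b c : B) : ∃ d : B, Ad (ex (ι b)) (ι c) = ι d := by
  let D : B →L[ℝ] B := pr.comp ((adMap hG (ι b)).comp ι)
  have hD : ∀ c, ι (D c) = lieBracket E (G := G) (ι b) (ι c) := fun c => hLie b c
  let z : ℝ → B := fun s => NormedSpace.exp (s • D) c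
  have hz : ∀ s, HasDerivAt z (D (z s)) s := fun s => by
    have h1 := hasDerivAt_exp_smul_const' (𝕂 := ℝ) D s
    have h2 := (ContinuousLinearMap.apply ℝ B c).hasFDerivAt.comp_hasDerivAt s h1
    exact h2
  have hcurve := eq_of_hasDirDeriv_zero (c := fun s => Ad (ex (-(s • ι b))) (ι (z s)))
    (fun s _ => by
      have h1 := (hasDirDeriv_iff_hasDerivAt.2 (hz s)).clm_comp ι
      have h2 := hex.hasDirDeriv_Ad hG (ι b) h1
      rw [hD, sub_self] at h2
      have h3 : Ad (ex (-(s • ι b))) (0 : E) = 0 := by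
        simpa using Ad_smul hG (ex (-(s • ι b))) 0 (0 : E)
      rwa [h3] at h2)
  have hz0 : z 0 = c := by simp [z]
  refine ⟨z 1, ?_⟩
  simp only [zero_smul, neg_zero, hex.zero, Ad_one, hz0, one_smul] at hcurve
  rw [← hcurve, ← Ad_mul hG, hex.neg, mul_inv_cancel, Ad_one]

theorem IsExponentialMap.expLogDeriv_mem (hG : IsLieGroup E G) (hex : IsExponentialMap E ex)
    (hpr : ∀ b, pr (ι b) = b)
    (hLie : ∀ b c : B, ι (pr (lieBracket E (G := G) (ι b) (ι c))) = lieBracket E (G := G) (ι b) (ι c))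
    (b c : B) : ι (pr (expLogDeriv ex (ι b) (ι c))) = expLogDeriv ex (ι b) (ι c) := by
  let Q : E →L[ℝ] E := ContinuousLinearMap.id ℝ E - ι.comp pr
  have hQ : ∀ x, Q x = x - ι (pr x) := fun x => rfl
  have h := eq_of_hasDirDeriv_zero
    (c := fun s : ℝ => Q (expLogDeriv ex (s • ι b) (s • ι c))) (fun s _ => by
      have h1 := (hex.hasDirDeriv_expLogDeriv hG (ι b) (ι c) s).clm_comp Q
      obtain ⟨d, hd⟩ := hex.Ad_mem hG hLie (-(s • b)) c
      rw [map_neg, map_smul] at hd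
      rwa [hd, hQ, hpr, sub_self] at h1)
  simp only [one_smul, zero_smul, hex.expLogDeriv_zero, map_zero, hQ, sub_self] at h
  exact (sub_eq_zero.1 h).symm

theorem IsExponentialMap.eventually_expLogDeriv_surjective (hG : IsLieGroup E G)
    (hex : IsExponentialMap E ex) (hpr : ∀ b, pr (ι b) = b)
    (hLie : ∀ b c : B, ι (pr (lieBracket E (G := G) (ι b) (ι c))) =
      lieBracket E (G := G) (ι b) (ι c)) :
    ∀ᶠ x in 𝓝 (0 : B), ∀ c : B, ∃ u : B, expLogDeriv ex (ι x) (ι u) = ι c := by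
  have hT : SmoothAt (fun q : B × B => pr (expLogDeriv ex (ι q.1) (ι q.2))) (0, 0) :=
    (hex.smoothAt_expLogDeriv hG ((smoothAt_fst _).clm_comp ι) ((smoothAt_snd _).clm_comp ι)).clm_comp
      pr
  have hhalf : (0 : ℝ) < 1 / 2 := by norm_num
  filter_upwards [hT.eventually_norm_sub_le (Eventually.of_forall fun x c u => by
    simp only [map_smul, ← hex.logDerivCLM_apply hG]) hhalf] with x hx c
  let A : B →L[ℝ] B := pr.comp ((hex.logDerivCLM hG (ι x)).comp ι)
  have hA : ‖1 - A‖ ≤ 1 / 2 := ContinuousLinearMap.opNorm_le_bound _ hhalf.le fun u => by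
    have := hx u
    simp only [map_zero, hex.expLogDeriv_zero, hpr] at this
    rw [norm_sub_rev] at this
    exact this
  have hAu : IsUnit A := by
    have := isUnit_one_sub_of_norm_lt_one (lt_of_le_of_lt hA (by norm_num))
    rwa [sub_sub_cancel] at this
  obtain ⟨a, ha⟩ := hAu
  refine ⟨(↑a⁻¹ : B →L[ℝ] B) c, ?_⟩
  rw [← hex.expLogDeriv_mem hG hpr hLie]
  congr 1
  have h4 := DFunLike.congr_fun (a.mul_inv) c
  rw [ha] at h4
  exact h4

end Invariance

/-! ### Charts of the maximal atlas -/

section MaxAtlas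

variable {X : Type*} [AddCommGroup X] [Module ℝ X] [TopologicalSpace X]
  [IsTopologicalAddGroup X] [ContinuousSMul ℝ X] [LocallyConvexSpace ℝ X] [T2Space X]
  {E : Type*} [AddCommGroup E] [Module ℝ E] [TopologicalSpace E]
  [IsTopologicalAddGroup E] [ContinuousSMul ℝ E] [LocallyConvexSpace ℝ E] [T2Space E]
  {M : Type*} [TopologicalSpace M] [ChartedSpace E M]

theorem mem_maxAtlas_of_smooth {e : OpenPartialHomeomorph M E}
    (h1 : ∀ z ∈ e.target, MSmoothAt E (fun z => e.symm z) z)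
    (h2 : ∀ e' ∈ atlas E M, ∀ z ∈ e'.target, e'.symm z ∈ e.source →
      SmoothAt (fun z => e (e'.symm z)) z) : e ∈ maxAtlas E M := by
  refine fun e' he' => ⟨smoothOn_of_smoothAt fun z hz => ?_, smoothOn_of_smoothAt fun z hz => ?_⟩
  · simp only [OpenPartialHomeomorph.trans_source, OpenPartialHomeomorph.symm_source,
      mem_inter_iff, mem_preimage] at hz
    exact (h1 z hz.1).2 e' he' hz.2
  · simp only [OpenPartialHomeomorph.trans_source, OpenPartialHomeomorph.symm_source,
      mem_inter_iff, mem_preimage] at hz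
    exact h2 e' he' z hz.1 hz.2

theorem MSmoothAt.chart_of_maxAtlas {e : OpenPartialHomeomorph M E} (he : e ∈ maxAtlas E M) {f : X → M}
    {x : X} (hf : MSmoothAt E f x) (hx : f x ∈ e.source) : SmoothAt (fun y => e (f y)) x := by
  set e' := chartAt E (f x)
  have h1 : SmoothAt (fun z => e (e'.symm z)) (e' (f x)) :=
    (he e' (chart_mem_atlas E _)).2.smoothAt (mem_chart_target E _) (by simpa [e'] using hx)
  refine (SmoothAt.comp (f := fun y => e' (f y)) h1
    (hf.2 e' (chart_mem_atlas E _) (mem_chart_source E _))).congr ?_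
  filter_upwards [hf.1 (e'.open_source.mem_nhds (mem_chart_source E _))] with y hy
  rw [e'.left_inv hy]

theorem mSmoothAt_symm_of_maxAtlas {e : OpenPartialHomeomorph M E} (he : e ∈ maxAtlas E M) {z : E}
    (hz : z ∈ e.target) : MSmoothAt E (fun z => e.symm z) z :=
  ⟨e.continuousAt_symm hz, fun e' he' hz' => (he e' he').1.smoothAt hz hz'⟩

end MaxAtlas

/-! ### Charts adapted to the cosets of the subgroup -/

section SliceChart

variable {E : Type*} [AddCommGroup E] [Module ℝ E] [TopologicalSpace E]
  [IsTopologicalAddGroup E] [ContinuousSMul ℝ E] [LocallyConvexSpace ℝ E] [T2Space E]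
  {G : Type*} [Group G] [TopologicalSpace G] [ChartedSpace E G]
  {ex : E → G}
  {B : Type*} [NormedAddCommGroup B] [NormedSpace ℝ B] [CompleteSpace B]
  {ι : B →L[ℝ] E} {pr : E →L[ℝ] B}

/-- There is a chart of `G` around `1` whose inverse is `c + b ↦ φ⁻¹(φ 1 + c) exp b` for `b` in the
image of `B` and `c` in the complement. For its construction, the implicit function theorem is used
to find, for `g` near `1`, an element `b` such that `φ (g (exp b)⁻¹) - φ 1` is in the complement. -/
theorem exists_sliceChart (hG : IsLieGroup E G) (hex : IsExponentialMap E ex)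
    (hpr : ∀ b, pr (ι b) = b) {P : E → Prop} (hP : ∀ᶠ e in 𝓝 0, P e) :
    ∃ ψ : OpenPartialHomeomorph G E, ψ ∈ maxAtlas E G ∧ 1 ∈ ψ.source ∧ ψ 1 = 0 ∧
      (∀ e, ψ.symm e = (oneChart E G).symm (oneCoord E G + (e - ι (pr e))) * ex (ι (pr e))) ∧
      ∀ e ∈ ψ.target, P e := by
  set φ := oneChart E G with hφ
  set p₀ : E := oneCoord E G with hp₀
  have hφp : φ.symm p₀ = 1 := oneChart_symm_oneCoord
  have hφ1 : φ 1 = p₀ := rfl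
  have hφs : ∀ᶠ z in 𝓝 p₀, z ∈ φ.target := φ.open_target.mem_nhds oneCoord_mem_target
  have hmul : MSmoothAt E (fun q : B × E => φ.symm q.2 * ex (ι q.1)) (0, p₀) :=
    (mSmoothAt_oneChart_symm hG (smoothAt_snd _) oneCoord_mem_target).mul hG
      (hex.comp ((smoothAt_fst _).clm_comp ι))
  have hmul1 : φ.symm p₀ * ex (ι 0) = 1 := by rw [hφp, map_zero, hex.zero, mul_one]
  let C : B × E → E := fun q => φ (φ.symm q.2 * ex (ι q.1)) - p₀
  have hC : SmoothAt C (0, p₀) := (hmul.oneChart_of_eq hmul1).sub (smoothAt_const _ _)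
  have hC0 : C (0, p₀) = 0 := by simp only [C, hmul1, hφ1, sub_self]
  have hdC : ∀ b, dirDeriv C (0, p₀) (b, 0) = ι b := fun b => by
    rw [hC.dirDeriv_left]
    have h1 : HasDirDeriv (fun x : B => φ (ex (ι x))) 0 b (ι b) := by
      have := ((hex.comp (smoothAt_clm ι 0)).oneChart_of_eq
        (by rw [map_zero, hex.zero])).hasDirDeriv b
      rwa [hex.dirDeriv_comp (smoothAt_clm ι 0) (map_zero ι), dirDeriv_clm] at this
    simp only [C, hφp, one_mul]
    simpa using (h1.sub (hasDirDeriv_const p₀ 0 b)).dirDeriv_eq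
  obtain ⟨ξ, hξ0, hξ, hiff⟩ := exists_implicit (F := fun q => pr (C q)) (x₀ := (0 : B)) (p₀ := p₀)
    (hC.clm_comp pr) (by rw [hC0, map_zero])
    (fun b => by rw [hC.dirDeriv_clm_comp, hdC, hpr])
  let a : E → E := fun z => -ι (ξ z) + C (ξ z, z)
  let b : E → G := fun e => φ.symm (p₀ + (e - ι (pr e))) * ex (ι (pr e))
  have hξq : Tendsto (fun z => (ξ z, z)) (𝓝 p₀) (𝓝 (0, p₀)) := by
    have := hξ.continuousAt.tendsto
    rw [hξ0] at this
    exact this.prodMk_nhds tendsto_id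
  have ha : SmoothAt a p₀ := by
    have hC' : SmoothAt C (ξ p₀, p₀) := by rwa [hξ0]
    exact (hξ.clm_comp ι).neg.add (SmoothAt.comp (f := fun z => (ξ z, z)) hC'
      (hξ.prodMk (smoothAt_id _)))
  have ha0 : a p₀ = 0 := by simp only [a, hξ0, hC0, map_zero, neg_zero, add_zero]
  have hb0 : b 0 = 1 := by simp [b, hφp, hex.zero]
  have hcoord : ∀ e : E, SmoothAt (fun e => p₀ + (e - ι (pr e))) e := fun e =>
    (smoothAt_const _ _).add ((smoothAt_id _).sub ((smoothAt_clm pr e).clm_comp ι))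
  have hbsm : ∀ e, p₀ + (e - ι (pr e)) ∈ φ.target → MSmoothAt E b e := fun e he =>
    (mSmoothAt_oneChart_symm hG (hcoord e) he).mul hG (hex.comp ((smoothAt_clm pr e).clm_comp ι))
  have hcoord0 : Tendsto (fun e => p₀ + (e - ι (pr e))) (𝓝 0) (𝓝 p₀) := by
    have := (hcoord 0).continuousAt.tendsto
    simpa using this
  have hb : MSmoothAt E b 0 := hbsm 0 (by
    rw [map_zero, map_zero, sub_zero, add_zero]; exact oneCoord_mem_target)
  have hbφ : Tendsto (fun e => φ (b e)) (𝓝 0) (𝓝 p₀) := by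
    have h := (hb.oneChart_of_eq hb0).continuousAt.tendsto
    rwa [hb0] at h
  -- the two maps are inverse to each other near the base points
  have hba : ∀ᶠ z in 𝓝 p₀, b (a z) = φ.symm z := by
    have h1 := hξq.eventually (hmul.1.eventually
      (φ.open_source.mem_nhds (by
        change φ.symm p₀ * ex (ι 0) ∈ φ.source
        rw [hmul1]; exact one_mem_source)))
    filter_upwards [hξq.eventually hiff, h1] with z hz hz1
    have h2 : pr (C (ξ z, z)) = 0 := hz.2 rfl
    have h3 : pr (a z) = -ξ z := by simp only [a, map_add, map_neg, hpr, h2, add_zero]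
    have h4 : p₀ + (a z - ι (pr (a z))) = φ (φ.symm z * ex (ι (ξ z))) := by
      rw [h3, map_neg, sub_neg_eq_add]
      simp only [a, C]
      abel
    simp only [b, h4]
    rw [φ.left_inv hz1, h3, map_neg, hex.neg, mul_inv_cancel_right]
  have hab : ∀ᶠ e in 𝓝 0, a (φ (b e)) = e := by
    have h1 : Tendsto (fun e => (-pr e, φ (b e))) (𝓝 0) (𝓝 ((0 : B), p₀)) := by
      have := (pr.continuous.tendsto 0).neg
      rw [map_zero, neg_zero] at this
      exact this.prodMk_nhds hbφ
    filter_upwards [h1.eventually hiff, hcoord0.eventually hφs, hb.eventually_mem_source hb0]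
      with e he he1 he2
    have h2 : C (-pr e, φ (b e)) = e - ι (pr e) := by
      simp only [C]
      rw [φ.left_inv he2]
      simp only [b]
      rw [map_neg, hex.neg, mul_inv_cancel_right, φ.right_inv he1, add_sub_cancel_left]
    have h3 : -pr e = ξ (φ (b e)) := he.1 (by rw [h2, map_sub, hpr, sub_self])
    simp only [a]
    rw [← h3, h2, map_neg, neg_neg, add_sub_cancel]
  obtain ⟨V, hVs, hV, h0V⟩ := mem_nhds_iff.1 ((hab.and (hcoord0.eventually hφs)).and hP)
  obtain ⟨W, hWs, hW, hpW⟩ := mem_nhds_iff.1 ((hba.and ha.eventually).and hφs)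
  let O : Set G := φ.source ∩ φ ⁻¹' W
  have hO : IsOpen O := φ.isOpen_inter_preimage hW
  have haO : ContinuousOn (fun g => a (φ g)) O := fun g hg =>
    (ContinuousAt.comp (f := φ) (hWs hg.2).1.2.continuousAt
      (φ.continuousAt hg.1)).continuousWithinAt
  have hbV : ContinuousOn b V := fun e he => (hbsm e (hVs he).1.2).1.continuousWithinAt
  have hO1 : (1 : G) ∈ O := ⟨one_mem_source, hpW⟩
  let ψ : OpenPartialHomeomorph G E :=
    { toFun := fun g => a (φ g)
      invFun := b
      source := O ∩ (fun g => a (φ g)) ⁻¹' V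
      target := V ∩ b ⁻¹' O
      map_source' := fun g hg => ⟨hg.2, by
        have h1 : b (a (φ g)) = g := by rw [(hWs hg.1.2).1.1, φ.left_inv hg.1.1]
        rw [mem_preimage, h1]
        exact hg.1⟩
      map_target' := fun e he => ⟨he.2, by
        have h1 : a (φ (b e)) = e := (hVs he.1).1.1
        rw [mem_preimage, h1]
        exact he.1⟩
      left_inv' := fun g hg => by rw [(hWs hg.1.2).1.1, φ.left_inv hg.1.1]
      right_inv' := fun e he => (hVs he.1).1.1
      open_source := haO.isOpen_inter_preimage hO hV
      open_target := hbV.isOpen_inter_preimage hV hO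
      continuousOn_toFun := haO.mono inter_subset_left
      continuousOn_invFun := hbV.mono inter_subset_left }
  refine ⟨ψ, mem_maxAtlas_of_smooth (fun e he => hbsm e (hVs he.1).1.2) ?_, ?_, ha0,
    fun e => rfl, fun e he => (hVs he.1).2⟩
  · intro e' he' z hz hz'
    have h1 : MSmoothAt E (fun z => e'.symm z) z :=
      MSmoothAt.chart_symm hG.toIsManifold he' (smoothAt_id z) hz
    exact SmoothAt.comp (f := fun z => φ (e'.symm z)) (hWs hz'.1.2).1.2 (h1.oneChart hz'.1.1)
  · refine ⟨hO1, ?_⟩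
    rw [mem_preimage, hφ1, ha0]
    exact h0V

/-- In an adapted chart, the complementary coordinate does not change to first order along the
one-parameter groups of the subalgebra. -/
theorem hasDirDeriv_sliceChart (hG : IsLieGroup E G) (hex : IsExponentialMap E ex)
    (hpr : ∀ b, pr (ι b) = b) {ψ : OpenPartialHomeomorph G E} (hψ : ψ ∈ maxAtlas E G)
    (hψs : ∀ e, ψ.symm e = (oneChart E G).symm (oneCoord E G + (e - ι (pr e))) * ex (ι (pr e)))
    (hsurj : ∀ e ∈ ψ.target, ∀ c, ∃ u, expLogDeriv ex (ι (pr e)) (ι u) = ι c)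
    {g : G} (hg : g ∈ ψ.source) (c : B) :
    HasDirDeriv (fun t : ℝ => ψ (g * ex (t • ι c)) - ι (pr (ψ (g * ex (t • ι c))))) 0 1 0 := by
  let Q : E →L[ℝ] E := ContinuousLinearMap.id ℝ E - ι.comp pr
  have hQ : ∀ x, Q x = x - ι (pr x) := fun x => rfl
  set e := ψ g with he
  have het : e ∈ ψ.target := ψ.map_source hg
  obtain ⟨u, hu⟩ := hsurj e het c
  have hline : ∀ x y : E, SmoothAt (fun t : ℝ => x + t • y) 0 := fun x y =>
    (smoothAt_const _ _).add (smoothAt_clm ((ContinuousLinearMap.id ℝ ℝ).smulRight y) 0)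
  have hlined : ∀ x y : E, dirDeriv (fun t : ℝ => x + t • y) 0 1 = y := fun x y => by
    have := ((hasDirDeriv_const x (0 : ℝ) (1 : ℝ)).add (hasDirDeriv_clm
      ((ContinuousLinearMap.id ℝ ℝ).smulRight y) 0 1)).dirDeriv_eq
    simpa using this
  -- the curve in the slice through `g` and the translated one-parameter group, both moved to `1`
  let f₁ : ℝ → G := fun t => ex (-ι (pr e)) * ex (ι (pr e) + t • ι u)
  let f₂ : ℝ → G := fun t => ex (t • ι c)
  have hf₁ : MSmoothAt E f₁ 0 := (mSmoothAt_const _ _).mul hG (hex.comp (hline _ _))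
  have hf₂ : MSmoothAt E f₂ 0 :=
    hex.comp (smoothAt_clm ((ContinuousLinearMap.id ℝ ℝ).smulRight (ι c)) 0)
  have h₁1 : f₁ 0 = 1 := by simp [f₁, hex.neg]
  have h₂1 : f₂ 0 = 1 := by simp [f₂, hex.zero]
  have hd₁ : dirDeriv (fun t => oneChart E G (f₁ t)) 0 1 = ι c := by
    have h1 : SmoothAt (fun y => oneChart E G (ex (-ι (pr e)) * ex y))
        (ι (pr e) + (0 : ℝ) • ι u) := by
      rw [zero_smul, add_zero]
      exact (hex.smoothAt_neg_mul hG (ι (pr e))).partial_right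
    have h2 := SmoothAt.dirDeriv_comp (f := fun t : ℝ => ι (pr e) + t • ι u) h1 (hline _ _) 1
    rw [hlined, zero_smul, add_zero] at h2
    exact h2.trans hu
  have hd₂ : dirDeriv (fun t => oneChart E G (f₂ t)) 0 1 = ι c := by
    have h1 := hex.dirDeriv_comp (hline 0 (ι c)) (by simp) 1
    rw [hlined] at h1
    simpa using h1
  have hU : SmoothAt (fun z => Q (ψ (g * (oneChart E G).symm z))) (oneCoord E G) :=
    (MSmoothAt.chart_of_maxAtlas hψ ((mSmoothAt_const g _).mul hG (mSmoothAt_oneChart_symm_self hG))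
      (by simpa using hg)).clm_comp Q
  have e₁ := dirDeriv_comp_of_eq_one (u := fun k : G => Q (ψ (g * k))) hU hf₁ h₁1 1
  have e₂ := dirDeriv_comp_of_eq_one (u := fun k : G => Q (ψ (g * k))) hU hf₂ h₂1 1
  have hslice : (fun t => Q (ψ (g * f₁ t))) =ᶠ[𝓝 0] fun _ => Q e := by
    have hc : Tendsto (fun t : ℝ => e + t • ι u) (𝓝 0) (𝓝 e) := tendsto_line e (ι u)
    filter_upwards [hc.eventually (ψ.open_target.mem_nhds het)] with t ht
    have h1 : ψ.symm (e + t • ι u) = g * f₁ t := by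
      have h2 := hψs e
      rw [he, ψ.left_inv hg, ← he] at h2
      have h3 : pr (e + t • ι u) = pr e + t • u := by rw [map_add, map_smul, hpr]
      have h4 : e + t • ι u - ι (pr e + t • u) = e - ι (pr e) := by
        rw [map_add, map_smul]; abel
      rw [hψs, h3, h4, map_add, map_smul]
      conv_rhs => rw [h2]
      simp only [f₁, hex.neg]
      group
    rw [← h1, ψ.right_inv ht, map_add, map_smul, hQ (ι u), hpr, sub_self, smul_zero, add_zero]
  rw [dirDeriv_congr hslice, dirDeriv_const] at e₁
  rw [hd₂, ← hd₁, ← e₁] at e₂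
  have hsm : SmoothAt (fun t => Q (ψ (g * f₂ t))) 0 :=
    (MSmoothAt.chart_of_maxAtlas hψ ((mSmoothAt_const g _).mul hG hf₂) (by rw [h₂1, mul_one]; exact hg)).clm_comp
      Q
  have := hsm.hasDirDeriv 1
  rwa [e₂] at this

/-- The complementary coordinate is constant along one-parameter groups of the subalgebra that stay in
the domain of an adapted chart. -/
theorem sliceChart_const (hG : IsLieGroup E G) (hex : IsExponentialMap E ex)
    (hpr : ∀ b, pr (ι b) = b) {ψ : OpenPartialHomeomorph G E} (hψ : ψ ∈ maxAtlas E G)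
    (hψs : ∀ e, ψ.symm e = (oneChart E G).symm (oneCoord E G + (e - ι (pr e))) * ex (ι (pr e)))
    (hsurj : ∀ e ∈ ψ.target, ∀ c, ∃ u, expLogDeriv ex (ι (pr e)) (ι u) = ι c)
    {g : G} {c : B} (hg : ∀ s ∈ Icc (0 : ℝ) 1, g * ex (s • ι c) ∈ ψ.source) :
    ψ (g * ex (ι c)) - ι (pr (ψ (g * ex (ι c)))) = ψ g - ι (pr (ψ g)) := by
  have h := eq_of_hasDirDeriv_zero
    (c := fun t : ℝ => ψ (g * ex (t • ι c)) - ι (pr (ψ (g * ex (t • ι c))))) (fun s hs => by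
      refine Tendsto.congr (fun t => ?_)
        (hasDirDeriv_sliceChart hG hex hpr hψ hψs hsurj (hg s hs) c)
      simp only [smul_eq_mul, mul_one, zero_add, zero_smul, hex.zero, mul_assoc, ← hex.add])
  simpa only [one_smul, zero_smul, hex.zero, mul_one] using h

end SliceChart

/-! ### The local group law -/

section LocalGroup

variable {E : Type*} [AddCommGroup E] [Module ℝ E] [TopologicalSpace E]
  [IsTopologicalAddGroup E] [ContinuousSMul ℝ E] [LocallyConvexSpace ℝ E] [T2Space E]
  {G : Type*} [Group G] [TopologicalSpace G] [ChartedSpace E G]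
  {ex : E → G}
  {B : Type*} [NormedAddCommGroup B] [NormedSpace ℝ B]
  {ι : B →L[ℝ] E} {pr : E →L[ℝ] B} {ψ : OpenPartialHomeomorph G E} {R : ℝ}

/-- The chart `ψ` straightens the local subgroup `exp (ι b)`, `‖b‖ < R`, and products of two elements
of this local subgroup are exponentials of their `B`-coordinate in the chart. -/
structure IsLocalExpChart (ex : E → G) (ι : B →L[ℝ] E) (pr : E →L[ℝ] B)
    (ψ : OpenPartialHomeomorph G E) (R : ℝ) : Prop where
  mem_maxAtlas : ψ ∈ maxAtlas E G
  pos : 0 < R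
  pr_ι : ∀ b, pr (ι b) = b
  exp_mem : ∀ x, ‖x‖ < R → ex (ι x) ∈ ψ.source
  chart_exp : ∀ x, ‖x‖ < R → ψ (ex (ι x)) = ι x
  mul_mem : ∀ x y, ‖x‖ < R → ‖y‖ < R → ex (ι x) * ex (ι y) ∈ ψ.source
  mul_eq : ∀ x y, ‖x‖ < R → ‖y‖ < R →
    ex (ι x) * ex (ι y) = ex (ι (pr (ψ (ex (ι x) * ex (ι y)))))

theorem exists_isLocalExpChart [CompleteSpace B] (hG : IsLieGroup E G)
    (hex : IsExponentialMap E ex) (hpr : ∀ b, pr (ι b) = b)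
    (hLie : ∀ b c : B, ι (pr (lieBracket E (G := G) (ι b) (ι c))) =
      lieBracket E (G := G) (ι b) (ι c)) :
    ∃ (ψ : OpenPartialHomeomorph G E) (R : ℝ), IsLocalExpChart ex ι pr ψ R := by
  have hP : ∀ᶠ e in 𝓝 (0 : E), ∀ c : B, ∃ u : B, expLogDeriv ex (ι (pr e)) (ι u) = ι c := by
    have := pr.continuous.tendsto 0
    rw [map_zero] at this
    exact this.eventually (hex.eventually_expLogDeriv_surjective hG hpr hLie)
  obtain ⟨ψ, hψ, h1, hψ1, hψs, hsurj⟩ := exists_sliceChart hG hex hpr hP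
  have e1 : ∀ᶠ q : B × B in 𝓝 (0, 0), ex (ι q.1) * ex (ι q.2) ∈ ψ.source := by
    have hm : MSmoothAt E (fun q : B × B => ex (ι q.1) * ex (ι q.2)) (0, 0) :=
      (hex.comp ((smoothAt_fst _).clm_comp ι)).mul hG (hex.comp ((smoothAt_snd _).clm_comp ι))
    refine hm.1 (ψ.open_source.mem_nhds ?_)
    simpa [hex.zero] using h1
  have e2 : ∀ᶠ q : B × B in 𝓝 (0, 0), ι q.1 ∈ ψ.target := by
    have hc : Continuous fun q : B × B => ι q.1 := by fun_prop
    refine hc.continuousAt (ψ.open_target.mem_nhds ?_)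
    rw [map_zero, ← hψ1]
    exact ψ.map_source h1
  obtain ⟨R, hR, hball⟩ := Metric.eventually_nhds_iff.1 (e1.and e2)
  have hmem : ∀ x y : B, ‖x‖ < R → ‖y‖ < R → ex (ι x) * ex (ι y) ∈ ψ.source ∧ ι x ∈ ψ.target :=
    fun x y hx hy => hball (y := (x, y)) (by
      rw [Prod.dist_eq, dist_zero_right, dist_zero_right]; exact max_lt hx hy)
  have hsymm : ∀ x : B, ψ.symm (ι x) = ex (ι x) := fun x => by
    rw [hψs, hpr, sub_self, add_zero, oneChart_symm_oneCoord, one_mul]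
  have hmem1 : ∀ x, ‖x‖ < R → ex (ι x) ∈ ψ.source := fun x hx => by
    rw [← hsymm]
    exact ψ.map_target (hmem x x hx hx).2
  have hch : ∀ x, ‖x‖ < R → ψ (ex (ι x)) = ι x := fun x hx => by
    rw [← hsymm, ψ.right_inv (hmem x x hx hx).2]
  refine ⟨ψ, R, hψ, hR, hpr, hmem1, hch, fun x y hx hy => (hmem x y hx hy).1, fun x y hx hy => ?_⟩
  have hc := sliceChart_const hG hex hpr hψ hψs hsurj (g := ex (ι x)) (c := y) (fun s hs => by
    rw [← map_smul]
    refine (hmem x (s • y) hx ?_).1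
    rw [norm_smul, Real.norm_eq_abs, abs_of_nonneg hs.1]
    exact (mul_le_of_le_one_left (norm_nonneg y) hs.2).trans_lt hy)
  rw [hch x hx, hpr, sub_self] at hc
  exact (ψ.left_inv (hmem x y hx hy).1).symm.trans
    ((congrArg ψ.symm (sub_eq_zero.1 hc)).trans (hsymm _))

/-- The local group law on `B` in exponential coordinates. -/
noncomputable def expMul (ex : E → G) (ι : B →L[ℝ] E) (pr : E →L[ℝ] B)
    (ψ : OpenPartialHomeomorph G E) (x y : B) : B := pr (ψ (ex (ι x) * ex (ι y)))

theorem IsLocalExpChart.tendsto_expMul (h : IsLocalExpChart ex ι pr ψ R) (hG : IsLieGroup E G)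
    (hex : IsExponentialMap E ex) {x y : B} (hx : ‖x‖ < R) (hy : ‖y‖ < R) :
    Tendsto (fun q : B × B => expMul ex ι pr ψ q.1 q.2) (𝓝 (x, y)) (𝓝 (expMul ex ι pr ψ x y)) := by
  have hm : MSmoothAt E (fun q : B × B => ex (ι q.1) * ex (ι q.2)) (x, y) :=
    (hex.comp ((smoothAt_fst _).clm_comp ι)).mul hG (hex.comp ((smoothAt_snd _).clm_comp ι))
  exact ((hm.chart_of_maxAtlas h.mem_maxAtlas (h.mul_mem x y hx hy)).clm_comp pr).continuousAt

theorem IsLocalExpChart.expMul_zero_right (h : IsLocalExpChart ex ι pr ψ R)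
    (hex : IsExponentialMap E ex) {x : B} (hx : ‖x‖ < R) : expMul ex ι pr ψ x 0 = x := by
  rw [expMul, map_zero, hex.zero, mul_one, h.chart_exp x hx, h.pr_ι]

theorem IsLocalExpChart.expMul_neg_right (h : IsLocalExpChart ex ι pr ψ R)
    (hex : IsExponentialMap E ex) (x : B) : expMul ex ι pr ψ x (-x) = 0 := by
  have h0 := h.chart_exp 0 (by simpa using h.pos)
  rw [map_zero, hex.zero] at h0
  rw [expMul, map_neg, hex.neg, mul_inv_cancel, h0, map_zero]

theorem IsLocalExpChart.expMul_neg_left (h : IsLocalExpChart ex ι pr ψ R)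
    (hex : IsExponentialMap E ex) (x : B) : expMul ex ι pr ψ (-x) x = 0 := by
  simpa using h.expMul_neg_right hex (-x)

/-- The subgroup of `G` generated by the exponentials of small elements. -/
def expSubgroup (ex : E → G) (ι : B →L[ℝ] E) (R : ℝ) : Subgroup G :=
  Subgroup.closure ((fun x => ex (ι x)) '' Metric.ball 0 R)

theorem IsExponentialMap.natCast_smul (hex : IsExponentialMap E ex) (n : ℕ) (v : E) :
    ex ((n : ℝ) • v) = ex v ^ n := by
  induction n with
  | zero => simp [hex.zero]
  | succ n ih => rw [Nat.cast_succ, hex.add, ih, one_smul, pow_succ]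

theorem IsExponentialMap.mem_expSubgroup (hex : IsExponentialMap E ex) (hR : 0 < R) (x : B) :
    ex (ι x) ∈ expSubgroup ex ι R := by
  obtain ⟨n, hn⟩ := exists_nat_gt (‖x‖ / R)
  have hn0 : (0 : ℝ) < n := lt_of_le_of_lt (by positivity) hn
  have e : ι x = (n : ℝ) • ι ((n : ℝ)⁻¹ • x) := by
    rw [map_smul, smul_smul, mul_inv_cancel₀ hn0.ne', one_smul]
  rw [e, hex.natCast_smul]
  have hmem : (n : ℝ)⁻¹ • x ∈ Metric.ball (0 : B) R := ?_
  · exact Subgroup.pow_mem _ (Subgroup.subset_closure (mem_image_of_mem _ hmem)) n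
  rw [mem_ball_zero_iff, norm_smul, norm_inv, Real.norm_eq_abs, abs_of_pos hn0, inv_mul_lt_iff₀ hn0]
  rwa [div_lt_iff₀ hR] at hn

/-- Conjugation by an element of the subgroup is continuous at `1` in exponential coordinates. -/
theorem IsLocalExpChart.conj (h : IsLocalExpChart ex ι pr ψ R) (hG : IsLieGroup E G)
    (hex : IsExponentialMap E ex) {g : G} (hg : g ∈ expSubgroup ex ι R) :
    ∀ r > 0, ∃ δ > 0, ∀ x : B, ‖x‖ < δ → ∃ y : B, ‖y‖ < r ∧ g * ex (ι x) * g⁻¹ = ex (ι y) := by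
  have hgen : ∀ z : B, ‖z‖ < R → ∀ r > 0, ∃ δ > 0, ∀ x : B, ‖x‖ < δ →
      ∃ y : B, ‖y‖ < r ∧ ex (ι z) * ex (ι x) * (ex (ι z))⁻¹ = ex (ι y) := fun z hz r hr => by
    have hz' : ‖-z‖ < R := by rwa [norm_neg]
    have h0 : ‖(0 : B)‖ < R := by simpa using h.pos
    have t1 : Tendsto (fun x => expMul ex ι pr ψ z x) (𝓝 0) (𝓝 z) := by
      have t2 : Tendsto (fun x : B => (z, x)) (𝓝 0) (𝓝 (z, 0)) :=
        tendsto_const_nhds.prodMk_nhds tendsto_id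
      have := (h.tendsto_expMul hG hex hz h0).comp t2
      rwa [h.expMul_zero_right hex hz] at this
    have t3 : Tendsto (fun x => expMul ex ι pr ψ (expMul ex ι pr ψ z x) (-z)) (𝓝 0) (𝓝 0) := by
      have t2 : Tendsto (fun x : B => (expMul ex ι pr ψ z x, -z)) (𝓝 0) (𝓝 (z, -z)) :=
        t1.prodMk_nhds tendsto_const_nhds
      have := (h.tendsto_expMul hG hex hz hz').comp t2
      rwa [h.expMul_neg_right hex] at this
    have e1 : ∀ᶠ x in 𝓝 (0 : B), ‖x‖ < R :=
      continuous_norm.continuousAt.eventually_lt continuousAt_const h0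
    have e2 := t1.norm.eventually_lt_const hz
    have e3 := t3.norm.eventually_lt_const (by rwa [norm_zero] : ‖(0 : B)‖ < r)
    obtain ⟨δ, hδ, hball⟩ := Metric.eventually_nhds_iff.1 ((e1.and e2).and e3)
    refine ⟨δ, hδ, fun x hx => ?_⟩
    obtain ⟨⟨a1, a2⟩, a3⟩ := hball (y := x) (by rwa [dist_zero_right])
    refine ⟨_, a3, ?_⟩
    rw [← hex.neg, ← map_neg, h.mul_eq z x hz a1]
    exact h.mul_eq _ _ a2 hz'
  induction hg using Subgroup.closure_induction'' with
  | mem g hg =>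
    obtain ⟨z, hz, rfl⟩ := hg
    exact hgen z (mem_ball_zero_iff.1 hz)
  | inv_mem g hg =>
    obtain ⟨z, hz, rfl⟩ := hg
    have := hgen (-z) (by rw [norm_neg]; exact mem_ball_zero_iff.1 hz)
    simpa only [map_neg, hex.neg] using this
  | one => exact fun r hr => ⟨r, hr, fun x hx => ⟨x, hx, by simp⟩⟩
  | mul g k _ _ hg hk =>
    intro r hr
    obtain ⟨δ, hδ, h1⟩ := hg r hr
    obtain ⟨δ', hδ', h2⟩ := hk δ hδ
    refine ⟨δ', hδ', fun x hx => ?_⟩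
    obtain ⟨y, hy, hy'⟩ := h2 x hx
    obtain ⟨z, hz, hz'⟩ := h1 y hy
    refine ⟨z, hz, ?_⟩
    rw [← hz', ← hy']
    group

end LocalGroup

/-! ### The Lie group structure on the subgroup -/

section Subgroup

variable {E : Type*} [AddCommGroup E] [Module ℝ E] [TopologicalSpace E]
  [IsTopologicalAddGroup E] [ContinuousSMul ℝ E] [LocallyConvexSpace ℝ E] [T2Space E]
  {G : Type*} [Group G] [TopologicalSpace G] [ChartedSpace E G]
  {ex : E → G}
  {B : Type*} [NormedAddCommGroup B] [NormedSpace ℝ B]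
  {ι : B →L[ℝ] E} {pr : E →L[ℝ] B} {ψ : OpenPartialHomeomorph G E} {R : ℝ}
  {H : Type*} [Group H] {j : H →* G} {exH : B → H}

/-- The exponentials of elements of `B` lift along the injective homomorphism `j`, and conjugation in
`H` is continuous at `1` in exponential coordinates. -/
structure IsExpLift (ex : E → G) (ι : B →L[ℝ] E) (j : H →* G) (exH : B → H) : Prop where
  injective : Function.Injective j
  map_exp : ∀ x, j (exH x) = ex (ι x)
  conj : ∀ (g : H), ∀ r > 0, ∃ δ > 0, ∀ x : B, ‖x‖ < δ → ∃ y : B, ‖y‖ < r ∧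
    g * exH x * g⁻¹ = exH y

theorem IsExpLift.exp_zero (l : IsExpLift ex ι j exH) (hex : IsExponentialMap E ex) :
    exH 0 = 1 := l.injective (by rw [l.map_exp, map_zero, hex.zero, map_one])

theorem IsExpLift.exp_neg (l : IsExpLift ex ι j exH) (hex : IsExponentialMap E ex) (x : B) :
    exH (-x) = (exH x)⁻¹ :=
  l.injective (by rw [l.map_exp, map_neg, hex.neg, map_inv, l.map_exp])

theorem IsExpLift.exp_mul (l : IsExpLift ex ι j exH) (h : IsLocalExpChart ex ι pr ψ R) {x y : B}
    (hx : ‖x‖ < R) (hy : ‖y‖ < R) : exH x * exH y = exH (expMul ex ι pr ψ x y) :=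
  l.injective (by rw [map_mul, l.map_exp, l.map_exp, l.map_exp, h.mul_eq x y hx hy, expMul])

/-- The images of small balls in `B` under the exponential map are a basis of neighbourhoods of `1` for
a group topology on `H`. -/
@[reducible]
def expGroupFilterBasis (l : IsExpLift ex ι j exH) (h : IsLocalExpChart ex ι pr ψ R)
    (hG : IsLieGroup E G) (hex : IsExponentialMap E ex) : GroupFilterBasis H where
  sets := {V | ∃ r > 0, V = exH '' Metric.ball 0 r}
  nonempty := ⟨_, 1, one_pos, rfl⟩
  inter_sets := by
    rintro _ _ ⟨r, hr, rfl⟩ ⟨s, hs, rfl⟩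
    exact ⟨_, ⟨min r s, lt_min hr hs, rfl⟩, subset_inter
      (image_mono (Metric.ball_subset_ball (min_le_left _ _)))
      (image_mono (Metric.ball_subset_ball (min_le_right _ _)))⟩
  one' := by
    rintro _ ⟨r, hr, rfl⟩
    exact ⟨0, Metric.mem_ball_self hr, l.exp_zero hex⟩
  mul' := by
    rintro _ ⟨r, hr, rfl⟩
    have h0 : ‖(0 : B)‖ < R := by simpa using h.pos
    have t := h.tendsto_expMul hG hex h0 h0
    rw [h.expMul_zero_right hex h0] at t
    obtain ⟨δ, hδ, hball⟩ := Metric.eventually_nhds_iff.1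
      (t.eventually (Metric.ball_mem_nhds 0 hr))
    refine ⟨_, ⟨min δ R, lt_min hδ h.pos, rfl⟩, ?_⟩
    rintro _ ⟨_, ⟨x, hx, rfl⟩, _, ⟨y, hy, rfl⟩, rfl⟩
    rw [mem_ball_zero_iff, lt_min_iff] at hx hy
    have hxy : dist (x, y) ((0 : B), (0 : B)) < δ := by
      rw [Prod.dist_eq, dist_zero_right, dist_zero_right]
      exact max_lt hx.1 hy.1
    exact ⟨_, hball hxy, (l.exp_mul h hx.2 hy.2).symm⟩
  inv' := by
    rintro _ ⟨r, hr, rfl⟩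
    refine ⟨_, ⟨r, hr, rfl⟩, ?_⟩
    rintro _ ⟨x, hx, rfl⟩
    exact ⟨-x, by simpa using hx, l.exp_neg hex x⟩
  conj' := by
    rintro g _ ⟨r, hr, rfl⟩
    obtain ⟨δ, hδ, hc⟩ := l.conj g r hr
    refine ⟨_, ⟨δ, hδ, rfl⟩, ?_⟩
    rintro _ ⟨x, hx, rfl⟩
    obtain ⟨y, hy, hy'⟩ := hc x (mem_ball_zero_iff.1 hx)
    exact ⟨y, mem_ball_zero_iff.2 hy, hy'.symm⟩

theorem nhds_one_expGroupFilterBasis (l : IsExpLift ex ι j exH) (h : IsLocalExpChart ex ι pr ψ R)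
    (hG : IsLieGroup E G) (hex : IsExponentialMap E ex) :
    @nhds H (expGroupFilterBasis l h hG hex).topology 1 = map exH (𝓝 0) := by
  refine (GroupFilterBasis.nhds_one_hasBasis (expGroupFilterBasis l h hG hex)).eq_of_same_basis ?_
  refine (Metric.nhds_basis_ball.map exH).to_hasBasis ?_ ?_
  · intro r hr
    exact ⟨_, ⟨r, hr, rfl⟩, subset_rfl⟩
  · rintro _ ⟨r, hr, rfl⟩
    exact ⟨r, hr, subset_rfl⟩

variable [TopologicalSpace H] [IsTopologicalGroup H]

theorem IsExpLift.nhds_eq (hn : 𝓝 (1 : H) = map exH (𝓝 0)) (g : H) :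
    𝓝 g = map (fun x => g * exH x) (𝓝 0) := by
  rw [← map_mul_left_nhds_one g, hn, Filter.map_map]
  rfl

theorem IsExpLift.continuous (l : IsExpLift ex ι j exH) (hG : IsLieGroup E G)
    (hex : IsExponentialMap E ex) (hn : 𝓝 (1 : H) = map exH (𝓝 0)) : Continuous j := by
  have := hG.isTopologicalGroup
  refine continuous_of_continuousAt_one j ?_
  rw [ContinuousAt, hn, tendsto_map'_iff, map_one]
  have h1 := (hex.comp (smoothAt_clm ι 0)).1.tendsto
  rw [map_zero, hex.zero] at h1
  exact h1.congr fun x => (l.map_exp x).symm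

theorem IsExpLift.continuousAt_exp (l : IsExpLift ex ι j exH) (h : IsLocalExpChart ex ι pr ψ R)
    (hG : IsLieGroup E G) (hex : IsExponentialMap E ex) (hn : 𝓝 (1 : H) = map exH (𝓝 0)) {x : B}
    (hx : ‖x‖ < R) : ContinuousAt exH x := by
  have hx' : ‖-x‖ < R := by rwa [norm_neg]
  have t : Tendsto (fun y => expMul ex ι pr ψ (-x) y) (𝓝 x) (𝓝 0) := by
    have t1 : Tendsto (fun y : B => (-x, y)) (𝓝 x) (𝓝 (-x, x)) :=
      tendsto_const_nhds.prodMk_nhds tendsto_id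
    have := (h.tendsto_expMul hG hex hx' hx).comp t1
    rwa [h.expMul_neg_left hex] at this
  rw [ContinuousAt, IsExpLift.nhds_eq hn]
  have t2 : Tendsto (fun y => exH x * exH (expMul ex ι pr ψ (-x) y)) (𝓝 x)
      (map (fun x' => exH x * exH x') (𝓝 0)) := tendsto_map.comp t
  refine t2.congr' ?_
  filter_upwards [continuous_norm.continuousAt.eventually_lt continuousAt_const hx] with y hy
  rw [← l.exp_mul h hx' hy, l.exp_neg hex, mul_inv_cancel_left]

theorem IsExpLift.isOpen_image_ball (l : IsExpLift ex ι j exH) (h : IsLocalExpChart ex ι pr ψ R)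
    (hG : IsLieGroup E G) (hex : IsExponentialMap E ex) (hn : 𝓝 (1 : H) = map exH (𝓝 0)) :
    IsOpen (exH '' Metric.ball 0 R) := by
  rw [isOpen_iff_mem_nhds]
  rintro _ ⟨x, hx, rfl⟩
  rw [mem_ball_zero_iff] at hx
  have h0 : ‖(0 : B)‖ < R := by simpa using h.pos
  rw [IsExpLift.nhds_eq hn, Filter.mem_map]
  have t : Tendsto (fun y => expMul ex ι pr ψ x y) (𝓝 0) (𝓝 x) := by
    have t1 : Tendsto (fun y : B => (x, y)) (𝓝 0) (𝓝 (x, 0)) :=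
      tendsto_const_nhds.prodMk_nhds tendsto_id
    have := (h.tendsto_expMul hG hex hx h0).comp t1
    rwa [h.expMul_zero_right hex hx] at this
  filter_upwards [continuous_norm.continuousAt.eventually_lt continuousAt_const h0,
    t.norm.eventually_lt_const hx] with y hy hy'
  exact ⟨_, mem_ball_zero_iff.2 hy', (l.exp_mul h hx hy).symm⟩

variable {S : Type*} [AddCommGroup S] [Module ℝ S] [TopologicalSpace S]
  [IsTopologicalAddGroup S] [ContinuousSMul ℝ S] [LocallyConvexSpace ℝ S] [T2Space S]
  {X : Type*} [AddCommGroup X] [Module ℝ X] [TopologicalSpace X]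
  [IsTopologicalAddGroup X] [ContinuousSMul ℝ X] [LocallyConvexSpace ℝ X] [T2Space X]

/-- The chart of `H` around `g` given by exponential coordinates of the translate to `1`, with values
in a model space `S` isomorphic to `B`. -/
@[simps]
def expChart (L : B ≃L[ℝ] S) (l : IsExpLift ex ι j exH) (h : IsLocalExpChart ex ι pr ψ R)
    (hG : IsLieGroup E G) (hex : IsExponentialMap E ex) (hn : 𝓝 (1 : H) = map exH (𝓝 0)) (g : H) :
    OpenPartialHomeomorph H S where
  toFun k := L (pr (ψ (j (g⁻¹ * k))))
  invFun s := g * exH (L.symm s)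
  source := {k | g⁻¹ * k ∈ exH '' Metric.ball 0 R}
  target := {s | ‖L.symm s‖ < R}
  map_source' := by
    rintro k ⟨x, hx, hk⟩
    rw [mem_ball_zero_iff] at hx
    rw [← hk, l.map_exp, h.chart_exp x hx, h.pr_ι]
    simpa using hx
  map_target' s hs := ⟨L.symm s, mem_ball_zero_iff.2 hs, by simp⟩
  left_inv' := by
    rintro k ⟨x, hx, hk⟩
    rw [mem_ball_zero_iff] at hx
    rw [← hk, l.map_exp, h.chart_exp x hx, h.pr_ι, L.symm_apply_apply, hk, mul_inv_cancel_left]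
  right_inv' s hs := by
    have hs : ‖L.symm s‖ < R := hs
    rw [inv_mul_cancel_left, l.map_exp, h.chart_exp _ hs, h.pr_ι, L.apply_symm_apply]
  open_source := (l.isOpen_image_ball h hG hex hn).preimage (continuous_const_mul g⁻¹)
  open_target := isOpen_lt (by fun_prop) continuous_const
  continuousOn_toFun := by
    rintro k ⟨x, hx, hk⟩
    have hk' : j (g⁻¹ * k) ∈ ψ.source := by
      rw [← hk, l.map_exp]
      exact h.exp_mem x (mem_ball_zero_iff.1 hx)
    have h1 : ContinuousAt (fun k => j (g⁻¹ * k)) k :=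
      ((l.continuous hG hex hn).comp (continuous_const_mul g⁻¹)).continuousAt
    have h2 : ContinuousAt (fun k => ψ (j (g⁻¹ * k))) k :=
      ContinuousAt.comp (f := fun k => j (g⁻¹ * k)) (ψ.continuousAt hk') h1
    exact ((L.continuous.comp pr.continuous).continuousAt.comp h2).continuousWithinAt
  continuousOn_invFun := fun s hs =>
    (continuousAt_const.mul (ContinuousAt.comp (f := fun s => L.symm s)
      (l.continuousAt_exp h hG hex hn hs) L.symm.continuous.continuousAt)).continuousWithinAt

/-- The manifold structure on `H` given by translated exponential charts. -/
@[reducible]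
def expChartedSpace (L : B ≃L[ℝ] S) (l : IsExpLift ex ι j exH) (h : IsLocalExpChart ex ι pr ψ R)
    (hG : IsLieGroup E G) (hex : IsExponentialMap E ex) (hn : 𝓝 (1 : H) = map exH (𝓝 0)) :
    ChartedSpace S H where
  atlas := range (expChart L l h hG hex hn)
  chartAt := expChart L l h hG hex hn
  mem_chart_source g := by
    change g⁻¹ * g ∈ exH '' Metric.ball 0 R
    rw [inv_mul_cancel]
    exact ⟨0, Metric.mem_ball_self h.pos, l.exp_zero hex⟩
  chart_mem_atlas g := mem_range_self g

theorem mSmoothAt_expChart_symm (L : B ≃L[ℝ] S) (l : IsExpLift ex ι j exH)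
    (h : IsLocalExpChart ex ι pr ψ R)
    (hG : IsLieGroup E G) (hex : IsExponentialMap E ex) (hn : 𝓝 (1 : H) = map exH (𝓝 0)) (g : H)
    (s : S) : MSmoothAt E (fun s => j ((expChart L l h hG hex hn g).symm s)) s := by
  simp only [expChart_symm_apply, map_mul, l.map_exp]
  exact (mSmoothAt_const _ _).mul hG (hex.comp
    ((smoothAt_clm (L.symm : S →L[ℝ] B) s).clm_comp ι))

/-- A map to `H` is smooth in an exponential chart if it is smooth as a map to `G`, because the chart
is the restriction of a chart of `G`. -/
theorem smoothAt_expChart (L : B ≃L[ℝ] S) (l : IsExpLift ex ι j exH)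
    (h : IsLocalExpChart ex ι pr ψ R)
    (hG : IsLieGroup E G) (hex : IsExponentialMap E ex) (hn : 𝓝 (1 : H) = map exH (𝓝 0)) (g : H)
    {f : X → H} {x : X} (hf : MSmoothAt E (fun y => j (f y)) x)
    (hx : f x ∈ (expChart L l h hG hex hn g).source) :
    SmoothAt (fun y => expChart L l h hG hex hn g (f y)) x := by
  obtain ⟨b, hb, hb'⟩ := hx
  simp only [expChart_apply, map_mul]
  refine SmoothAt.clm_comp (SmoothAt.clm_comp (MSmoothAt.chart_of_maxAtlas h.mem_maxAtlas
    ((mSmoothAt_const (j g⁻¹) x).mul hG hf) ?_) pr) (L : B →L[ℝ] S)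
  rw [← map_mul, ← hb', l.map_exp]
  exact h.exp_mem b (mem_ball_zero_iff.1 hb)

theorem isLieGroup_expChartedSpace (L : B ≃L[ℝ] S) (l : IsExpLift ex ι j exH)
    (h : IsLocalExpChart ex ι pr ψ R)
    (hG : IsLieGroup E G) (hex : IsExponentialMap E ex) (hn : 𝓝 (1 : H) = map exH (𝓝 0)) :
    letI := expChartedSpace L l h hG hex hn
    IsLieGroup S H := by
  let := expChartedSpace L l h hG hex hn
  have hsm : ∀ {X : Type _} [AddCommGroup X] [Module ℝ X] [TopologicalSpace X]
      [IsTopologicalAddGroup X] [ContinuousSMul ℝ X] [LocallyConvexSpace ℝ X] [T2Space X]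
      {f : X → H} {x : X}, ContinuousAt f x → MSmoothAt E (fun y => j (f y)) x →
      MSmoothAt S f x := fun hc hf => by
    refine ⟨hc, ?_⟩
    rintro _ ⟨g, rfl⟩ hx
    exact smoothAt_expChart L l h hG hex hn g hf hx
  have := hG.t2
  refine
    { t2 := T2Space.of_injective_continuous l.injective (l.continuous hG hex hn)
      smooth_change := ?_
      smooth_mul := SmoothMap.of_mSmoothAt continuous_mul ?_
      smooth_inv := SmoothMap.of_mSmoothAt continuous_inv ?_ }
  · rintro _ ⟨g, rfl⟩ _ ⟨k, rfl⟩
    refine smoothOn_of_smoothAt fun z hz => ?_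
    exact smoothAt_expChart L l h hG hex hn k (mSmoothAt_expChart_symm L l h hG hex hn g z) hz.2
  · rintro _ ⟨_, ⟨g, rfl⟩, _, ⟨k, rfl⟩, rfl⟩ z hz
    refine hsm ?_ ?_
    · exact continuous_mul.continuousAt.comp (OpenPartialHomeomorph.continuousAt_symm _ hz)
    · simp only [map_mul]
      exact MSmoothAt.mul hG
        ((mSmoothAt_expChart_symm L l h hG hex hn g z.1).comp (smoothAt_fst z))
        ((mSmoothAt_expChart_symm L l h hG hex hn k z.2).comp (smoothAt_snd z))
  · rintro _ ⟨g, rfl⟩ z hz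
    refine hsm ?_ ?_
    · exact continuous_inv.continuousAt.comp (OpenPartialHomeomorph.continuousAt_symm _ hz)
    · simp only [map_inv]
      exact (mSmoothAt_expChart_symm L l h hG hex hn g z).inv hG

/-- The left translate of a chart of the maximal atlas is again in the maximal atlas. -/
theorem exists_translate_mem_maxAtlas (hG : IsLieGroup E G) (hψ : ψ ∈ maxAtlas E G) (g : G) :
    ∃ ψ' ∈ maxAtlas E G, (∀ k, k ∈ ψ'.source ↔ g⁻¹ * k ∈ ψ.source) ∧ ∀ k, ψ' k = ψ (g⁻¹ * k) := by
  have := hG.isTopologicalGroup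
  refine ⟨(Homeomorph.mulLeft g⁻¹).toOpenPartialHomeomorph.trans ψ, mem_maxAtlas_of_smooth ?_ ?_,
    fun k => by simp, fun k => rfl⟩
  · intro z hz
    have hz : z ∈ ψ.target := by simpa using hz
    refine ((mSmoothAt_const g z).mul hG (mSmoothAt_symm_of_maxAtlas hψ hz)).congr ?_
    exact Eventually.of_forall fun z => by
      change g * ψ.symm z = g⁻¹⁻¹ * ψ.symm z
      rw [inv_inv]
  · intro e' he' z hz hz'
    have hz' : g⁻¹ * e'.symm z ∈ ψ.source := by simpa using hz'
    exact MSmoothAt.chart_of_maxAtlas hψ ((mSmoothAt_const g⁻¹ z).mul hG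
      (MSmoothAt.chart_symm hG.toIsManifold he' (smoothAt_id z) hz)) hz'

theorem mem_maxAtlas_of_mem_atlas {M : Type*} [TopologicalSpace M] [ChartedSpace E M]
    (hM : IsManifold E M) {e : OpenPartialHomeomorph M E} (he : e ∈ atlas E M) :
    e ∈ maxAtlas E M :=
  fun e' he' => ⟨hM.smooth_change e he e' he', hM.smooth_change e' he' e he⟩

end Subgroup

end LCLie

theorem theorem3p1
    {E : Type*} [AddCommGroup E] [Module ℝ E] [TopologicalSpace E] [IsTopologicalAddGroup E]
    [ContinuousSMul ℝ E] [LocallyConvexSpace ℝ E] [T2Space E]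
    {G : Type*} [Group G] [TopologicalSpace G] [ChartedSpace E G]
    (hG : LCLie.IsLieGroup E G)
    (hexp : ∃ ex : LCLie.LieAlg E G → G, LCLie.IsExponentialMap E ex)
    (h : Submodule ℝ (LCLie.LieAlg E G))
    (hLie : LCLie.IsLieSubalgebra E G h)
    (hcompl : h.ClosedComplemented)
    (hBanach : LCLie.IsBanach h) :
    ∃ (H : Subgroup G) (S : Submodule ℝ E) (_ : TopologicalSpace H) (_ : ChartedSpace S H),
      LCLie.IsLieGroup S H ∧
      LCLie.IsImmersedSubmanifold E S (Subtype.val : H → G) ∧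
      Set.range (LCLie.tangentMap S E (Subtype.val : H → G) 1) = (h : Set E) := by
  obtain ⟨ex, hex⟩ := hexp
  obtain ⟨π, hπ⟩ := hcompl
  obtain ⟨B, _, _, _, ⟨L⟩⟩ := hBanach
  let S : Submodule ℝ E := h
  let L' : B ≃L[ℝ] S := L
  let ι : B →L[ℝ] E := S.subtypeL.comp (L' : B →L[ℝ] S)
  let pr : E →L[ℝ] B := (L'.symm : S →L[ℝ] B).comp π
  have hιS : ∀ b, ι b ∈ S := fun b => (L' b).2
  have hprS : ∀ x ∈ S, ι (pr x) = x := fun x hx => by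
    have h1 : π x = (⟨x, hx⟩ : S) := hπ ⟨x, hx⟩
    change ((L' (L'.symm (π x)) : S) : E) = x
    rw [L'.apply_symm_apply, h1]
  have hpr : ∀ b, pr (ι b) = b := fun b => by
    have h1 : π (ι b) = L' b := hπ (L' b)
    change L'.symm (π (ι b)) = b
    rw [h1, L'.symm_apply_apply]
  obtain ⟨ψ, R, hloc⟩ := LCLie.exists_isLocalExpChart (ex := ex) (ι := ι) (pr := pr) hG hex hpr
    (fun b c => hprS _ (hLie _ (hιS b) _ (hιS c)))
  let H : Subgroup G := LCLie.expSubgroup ex ι R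
  let exH : B → H := fun x => ⟨ex (ι x), hex.mem_expSubgroup hloc.pos x⟩
  have l : LCLie.IsExpLift ex ι H.subtype exH :=
    { injective := Subtype.val_injective
      map_exp := fun x => rfl
      conj := fun g r hr => by
        obtain ⟨δ, hδ, hc⟩ := hloc.conj hG hex g.2 r hr
        refine ⟨δ, hδ, fun x hx => ?_⟩
        obtain ⟨y, hy, hy'⟩ := hc x hx
        exact ⟨y, hy, Subtype.ext hy'⟩ }
  let tH : TopologicalSpace H := (LCLie.expGroupFilterBasis l hloc hG hex).topology
  have gH : IsTopologicalGroup H :=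
    GroupFilterBasis.isTopologicalGroup (LCLie.expGroupFilterBasis l hloc hG hex)
  have hn : 𝓝 (1 : H) = map exH (𝓝 0) := LCLie.nhds_one_expGroupFilterBasis l hloc hG hex
  let cH : ChartedSpace S H := LCLie.expChartedSpace L' l hloc hG hex hn
  have hLG : LCLie.IsLieGroup S H := LCLie.isLieGroup_expChartedSpace L' l hloc hG hex hn
  refine ⟨H, S, tH, cH, hLG, ?_, ?_⟩
  · refine
      { isClosed := Submodule.ClosedComplemented.isClosed ⟨π, hπ⟩
        isManifold := hLG.toIsManifold
        injective := Subtype.val_injective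
        continuous := l.continuous hG hex hn
        charts := fun p => ?_ }
    obtain ⟨ψ', hψ', hsrc, hval⟩ :=
      LCLie.exists_translate_mem_maxAtlas hG hloc.mem_maxAtlas (p : G)
    refine ⟨chartAt S p, LCLie.mem_maxAtlas_of_mem_atlas hLG.toIsManifold (chart_mem_atlas S p),
      ψ', hψ', mem_chart_source S p, ?_, ?_⟩
    · rintro q ⟨x, hx, hq⟩
      rw [hsrc]
      have h1 : (p : G)⁻¹ * (q : G) = ex (ι x) := congrArg Subtype.val hq.symm
      rw [h1]
      exact hloc.exp_mem x (mem_ball_zero_iff.1 hx)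
    · intro s hs
      have hs : ‖L'.symm s‖ < R := hs
      have h1 : (((chartAt S p).symm s : H) : G) = (p : G) * ex (ι (L'.symm s)) := rfl
      rw [hval, h1, inv_mul_cancel_left, hloc.chart_exp _ hs]
      change ((L' (L'.symm s) : S) : E) = s
      rw [L'.apply_symm_apply]
  · have hT : ∀ s : S, LCLie.tangentMap S E (Subtype.val : H → G) 1 s = (s : E) := fun s => by
      have h0 : chartAt S (1 : H) 1 = 0 := by
        change L' (pr (ψ (H.subtype (1⁻¹ * 1)))) = 0
        have h1 := hloc.chart_exp 0 (by simpa using hloc.pos)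
        rw [map_zero, hex.zero] at h1
        rw [inv_one, one_mul, map_one, h1, map_zero, map_zero]
      unfold LCLie.tangentMap
      rw [h0]
      have h2 : ∀ z : S, (((chartAt S (1 : H)).symm z : H) : G) = ex (z : E) := fun z => by
        change ((1 : H) : G) * ex ((L' (L'.symm z) : S) : E) = ex (z : E)
        rw [L'.apply_symm_apply, OneMemClass.coe_one, one_mul]
      simp only [h2]
      have h3 := hex.dirDeriv_comp (LCLie.smoothAt_clm S.subtypeL 0) (map_zero _) s
      rw [LCLie.dirDeriv_clm] at h3
      exact h3
    ext x
    constructor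
    · rintro ⟨s, rfl⟩
      rw [hT]
      exact s.2
    · intro hx
      exact ⟨⟨x, hx⟩, hT _⟩
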